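/- Let $\mathbb{F}_q$ be a finite field with $q$ elements, $k=\mathbb{F}_q(\theta)$, $k_\infty=\mathbb{F}_q((1/\theta))$ the completion of $k$ at its infinite place, $\mathbb{K}$ the completion of an algebraic closure of $k_\infty$ for the unique extension $|\cdot|_\infty$ of the $\infty$-adic absolute value, and $\overline{k}$ the algebraic closure of $k$ in $\mathbb{K}$. Let $\mathbb{T}$ be the ring of power series $\sum_{i\ge 0}a_it^i$ with $a_i\in\mathbb{K}$ and $|a_i|_\infty\to 0$, and let $\mathbb{L}$ be its fraction field, so that $\mathbb{F}_q(t)\subseteq\overline{k}(t)\subseteq\mathbb{L}$. Let $\sigma:\mathbb{L}\to\mathbb{L}$, $f\mapsto f^{(-1)}$, be the automorphism induced by $\sum a_it^i\mapsto\sum a_i^{1/q}t^i$ on $\mathbb{T}$; on matrices it acts entrywise. Let $r\ge 0$, and suppose that $\Phi\in\mathrm{GL}_r(\overline{k}(t))$ and $\Psi\in\mathrm{GL}_r(\mathbb{L})$ satisfy $\Psi^{(-1)}=\Phi\Psi$. 1. The field $\overline{k}(t)$ is algebraically closed in the field $\Lambda=\overline{k}(t)(\Psi)\subseteq\mathbb{L}$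 generated over $\overline{k}(t)$ by the entries of $\Psi$; that is, every element of $\Lambda$ that is algebraic over $\overline{k}(t)$ lies in $\overline{k}(t)$. 2. Let $\Psi_1=\Psi\otimes 1$ and $\Psi_2=1\otimes\Psi$ in $\mathrm{GL}_r(\mathbb{L}\otimes_{\overline{k}(t)}\mathbb{L})$, let $\Delta$ be the image of the $\mathbb{F}_q(t)$-algebra homomorphism $\mathbb{F}_q(t)[X,1/\det X]\to\mathbb{L}\otimes_{\overline{k}(t)}\mathbb{L}$ with $X\mapsto\Psi_1^{-1}\Psi_2$ (where $X$ is an $r\times r$ matrix of independent variables), and let $\Gamma=\operatorname{Spec}\Delta$ be the difference Galois group of $\Psi$. Then $\Gamma$ is smooth over an algebraic closure $\overline{\mathbb{F}_q(t)}$ of $\mathbb{F}_q(t)$: the $\overline{\mathbb{F}_q(t)}$-algebra $\overline{\mathbb{F}_q(t)}\otimes_{\mathbb{F}_q(t)}\Delta$ is smooth and, in particular, reduced. -/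

import Mathlib

noncomputable section

namespace TMotive

open scoped NNReal WithZero

/-! ### The fields `k_∞`, `𝕂` and `k̄`

Throughout `Fq` is a finite field with `q` elements, `k = Fq(θ)` is `RatFunc Fq`, and
`θ = RatFunc.X`. -/

section Fields

variable (Fq : Type*) [Field Fq]

open Classical in
/-- `k_∞ = Fq((1/θ))`, the completion of `Fq(θ)` at the infinite place. -/
def KInf : Type _ := RatFunc.CompletionAtInfty Fq

namespace KInf

open Classical in
instance : Field (KInf Fq) := inferInstanceAs (Field (RatFunc.CompletionAtInfty Fq))

open Classical in
instance : Algebra (RatFunc Fq) (KInf Fq) :=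
  inferInstanceAs (Algebra (RatFunc Fq) (RatFunc.CompletionAtInfty Fq))

open Classical in
instance : Valued (KInf Fq) ℤᵐ⁰ :=
  inferInstanceAs (Valued (RatFunc.CompletionAtInfty Fq) ℤᵐ⁰)

open Classical in
instance : CompleteSpace (KInf Fq) := by
  let : UniformSpace (RatFunc Fq) := (RatFunc.inftyValued Fq).toUniformSpace
  exact inferInstanceAs (CompleteSpace (UniformSpace.Completion (RatFunc Fq)))

open Classical in
theorem valuation_coe (x : RatFunc Fq) :
    Valued.v (algebraMap (RatFunc Fq) (KInf Fq) x) = RatFunc.inftyValuation Fq x := by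
  let := RatFunc.inftyValued Fq
  exact Valued.extensionValuation_apply_coe (K := RatFunc Fq) x

variable [Fintype Fq]

open MonoidWithZeroHom in
/-- The normalization `|θ| = q` of the `∞`-adic absolute value. -/
instance : Valuation.RankOne (Valued.v : Valuation (KInf Fq) ℤᵐ⁰) where
  hom' := (WithZeroMulInt.toNNReal (e := (Fintype.card Fq : ℝ≥0))
    (by simp)).comp ValueGroup₀.embedding
  strictMono' := (WithZeroMulInt.toNNReal_strictMono
    (by exact_mod_cast Fintype.one_lt_card)).comp ValueGroup₀.embedding_strictMono
  exists_val_nontrivial := by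
    refine ⟨algebraMap (RatFunc Fq) (KInf Fq) RatFunc.X, ?_⟩
    rw [valuation_coe, RatFunc.inftyValuation.X]
    simp

instance : NontriviallyNormedField (KInf Fq) :=
  Valued.toNontriviallyNormedField (L := KInf Fq) (Γ₀ := ℤᵐ⁰)

instance : IsUltrametricDist (KInf Fq) :=
  inferInstanceAs (@IsUltrametricDist (KInf Fq) (Valued.toNormedField (KInf Fq) ℤᵐ⁰).toDist)


instance : Algebra Fq (KInf Fq) :=
  ((algebraMap (RatFunc Fq) (KInf Fq)).comp (algebraMap Fq (RatFunc Fq))).toAlgebra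

instance : IsScalarTower Fq (RatFunc Fq) (KInf Fq) := IsScalarTower.of_algebraMap_eq' rfl

end KInf

variable [Fintype Fq]

/-- An algebraic closure of `k_∞`. -/
abbrev KInfBar : Type _ := AlgebraicClosure (KInf Fq)

namespace KInfBar

/-- The unique extension of the `∞`-adic absolute value, that is, the spectral norm. -/
instance : NormedField (KInfBar Fq) := spectralNorm.normedField (KInf Fq) (KInfBar Fq)

instance : NormedAlgebra (KInf Fq) (KInfBar Fq) := spectralNorm.normedAlgebra _ _

instance : IsUltrametricDist (KInfBar Fq) :=
  IsUltrametricDist.isUltrametricDist_of_forall_norm_add_le_max_norm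
    (isNonarchimedean_spectralNorm (K := KInf Fq) (L := KInfBar Fq))

instance (R : Type*) [CommSemiring R] [Algebra R (KInf Fq)] :
    UniformContinuousConstSMul R (KInfBar Fq) where
  uniformContinuous_const_smul c := by
    have h : (fun x : KInfBar Fq => c • x) = fun x => algebraMap R (KInf Fq) c • x := by
      ext x; rw [algebraMap_smul]
    change UniformContinuous (fun x : KInfBar Fq => c • x)
    rw [h]
    simpa only [Algebra.smul_def] using uniformContinuous_mul_left'
      (algebraMap (KInf Fq) (KInfBar Fq) (algebraMap R (KInf Fq) c))

end KInfBar

/-- `𝕂`, the completion of the algebraic closure of `k_∞`. -/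
abbrev CInf : Type _ := UniformSpace.Completion (KInfBar Fq)

namespace CInf

instance : IsUltrametricDist (CInf Fq) := by
  apply IsUltrametricDist.isUltrametricDist_of_forall_norm_add_le_max_norm
  intro x y
  refine UniformSpace.Completion.induction_on₂ x y
    (isClosed_le (by fun_prop) (by fun_prop)) fun a b => ?_
  rw [← UniformSpace.Completion.coe_add, UniformSpace.Completion.norm_coe,
    UniformSpace.Completion.norm_coe, UniformSpace.Completion.norm_coe]
  exact IsUltrametricDist.norm_add_le_max a b

theorem exists_pow_card_eq (x : CInf Fq) : ∃ y : CInf Fq, y ^ Fintype.card Fq = x := by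
  have hq : Fintype.card Fq ≠ 0 := Fintype.card_ne_zero
  have hex : ∀ a : KInfBar Fq, ∃ b : KInfBar Fq, b ^ Fintype.card Fq = a := fun a =>
    IsAlgClosed.exists_pow_nat_eq a (Nat.pos_of_ne_zero hq)
  choose g hg using hex
  have hsub : ∀ a b, ‖g a - g b‖ ^ Fintype.card Fq = ‖a - b‖ := by
    intro a b
    have h := map_sub (FiniteField.frobeniusAlgHom Fq (KInfBar Fq)) (g a) (g b)
    simp only [FiniteField.frobeniusAlgHom_apply, hg] at h
    rw [← norm_pow, h]
  have huc : UniformContinuous g := by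
    rw [Metric.uniformContinuous_iff]
    intro ε hε
    refine ⟨ε ^ Fintype.card Fq, by positivity, fun {a b} hab => ?_⟩
    rw [dist_eq_norm] at hab ⊢
    rw [← hsub] at hab
    exact lt_of_pow_lt_pow_left₀ _ hε.le hab
  refine ⟨UniformSpace.Completion.map g x, ?_⟩
  refine UniformSpace.Completion.induction_on x
    (isClosed_eq (UniformSpace.Completion.continuous_map.pow _) continuous_id) fun a => ?_
  rw [UniformSpace.Completion.map_coe huc]
  change (UniformSpace.Completion.coeRingHom (g a)) ^ Fintype.card Fq =
    UniformSpace.Completion.coeRingHom a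
  rw [← map_pow, hg]

/-- The automorphism `a ↦ a ^ q` of `𝕂`. -/
def frob : CInf Fq ≃+* CInf Fq :=
  RingEquiv.ofBijective (FiniteField.frobeniusAlgHom Fq (CInf Fq)).toRingHom
    ⟨(FiniteField.frobeniusAlgHom Fq (CInf Fq)).toRingHom.injective, exists_pow_card_eq Fq⟩

@[simp] theorem frob_apply (a : CInf Fq) : frob Fq a = a ^ Fintype.card Fq := rfl

end CInf

/-- `k̄`, the algebraic closure of `k = Fq(θ)` in `𝕂`. -/
abbrev KBar : IntermediateField (RatFunc Fq) (CInf Fq) := algebraicClosure (RatFunc Fq) (CInf Fq)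

end Fields

section Tate

variable (Fq : Type*) [Field Fq] [Fintype Fq]

/-- `𝕋`, the ring of power series `∑ aᵢ tⁱ` over `𝕂` with `|aᵢ| → 0`. -/
abbrev Tate : Type _ := PowerSeries.IsRestricted.subring (R := CInf Fq) 1

namespace Tate

theorem mem_iff (f : PowerSeries (CInf Fq)) :
    f ∈ PowerSeries.IsRestricted.subring (R := CInf Fq) 1 ↔
      Filter.Tendsto (fun n => ‖PowerSeries.coeff n f‖) Filter.atTop (nhds 0) := by
  change PowerSeries.IsRestricted 1 f ↔ _
  simp [PowerSeries.isRestricted_iff']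

theorem mem_map_frob_iff (f : PowerSeries (CInf Fq)) :
    PowerSeries.map (CInf.frob Fq).toRingHom f ∈
        PowerSeries.IsRestricted.subring (R := CInf Fq) 1 ↔
      f ∈ PowerSeries.IsRestricted.subring (R := CInf Fq) 1 := by
  have hq : Fintype.card Fq ≠ 0 := Fintype.card_ne_zero
  have h : ∀ n, ‖PowerSeries.coeff n (PowerSeries.map (CInf.frob Fq).toRingHom f)‖ =
      ‖PowerSeries.coeff n f‖ ^ Fintype.card Fq := fun n => by
    rw [PowerSeries.coeff_map, ← norm_pow]; rfl
  simp only [mem_iff, h]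
  constructor
  · intro H
    have := H.rpow_const (p := (Fintype.card Fq : ℝ)⁻¹) (Or.inr (by positivity))
    rw [Real.zero_rpow (by positivity)] at this
    refine this.congr fun n => ?_
    exact Real.pow_rpow_inv_natCast (norm_nonneg _) hq
  · intro H
    simpa [hq] using H.pow (Fintype.card Fq)

/-- The automorphism `f ↦ f⁽¹⁾`, `∑ aᵢ tⁱ ↦ ∑ aᵢ^q tⁱ`, of `𝕋`. -/
def frobTwist : Tate Fq ≃+* Tate Fq :=
  RingEquiv.ofBijective
    (((PowerSeries.map (CInf.frob Fq).toRingHom).comp (Subring.subtype _)).codRestrict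
      (PowerSeries.IsRestricted.subring (R := CInf Fq) 1)
      fun f => (mem_map_frob_iff Fq f).2 f.2) <| by
    constructor
    · intro f g hfg
      have h := congrArg Subtype.val hfg
      exact Subtype.ext (PowerSeries.map_injective _ (CInf.frob Fq).injective h)
    · intro f
      obtain ⟨g, hg⟩ := PowerSeries.map_surjective (CInf.frob Fq).toRingHom
        (CInf.frob Fq).surjective f.1
      exact ⟨⟨g, (mem_map_frob_iff Fq g).1 (by rw [hg]; exact f.2)⟩, Subtype.ext hg⟩

@[simp] theorem coeff_frobTwist (f : Tate Fq) (n : ℕ) :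
    PowerSeries.coeff n (frobTwist Fq f).1 = PowerSeries.coeff n f.1 ^ Fintype.card Fq := by
  change PowerSeries.coeff n (PowerSeries.map (CInf.frob Fq).toRingHom f.1) = _
  rw [PowerSeries.coeff_map]; rfl

/-- The constants `𝕂 → 𝕋`. -/
def const : CInf Fq →+* Tate Fq :=
  (PowerSeries.C (R := CInf Fq)).codRestrict _ fun a => PowerSeries.isRestricted_C 1 a

/-- The variable `t`, as an element of `𝕋`. -/
def t : Tate Fq := ⟨PowerSeries.X, PowerSeries.isRestricted_monomial 1 1 1⟩

end Tate

/-- `𝕃`, the fraction field of `𝕋`. -/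
def TateField : Type _ := FractionRing (Tate Fq)

namespace TateField

instance : Field (TateField Fq) := inferInstanceAs (Field (FractionRing (Tate Fq)))

instance : Algebra (Tate Fq) (TateField Fq) :=
  inferInstanceAs (Algebra (Tate Fq) (FractionRing (Tate Fq)))

instance : IsFractionRing (Tate Fq) (TateField Fq) :=
  inferInstanceAs (IsFractionRing (Tate Fq) (FractionRing (Tate Fq)))

/-- `σ(f) = f⁽⁻¹⁾` on `𝕃`: the automorphism induced by `∑ aᵢ tⁱ ↦ ∑ aᵢ^(1/q) tⁱ` on `𝕋`. -/
def sigma : TateField Fq ≃+* TateField Fq :=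
  IsFractionRing.ringEquivOfRingEquiv (Tate.frobTwist Fq).symm

/-- The constants `𝕂 → 𝕃`. -/
def const : CInf Fq →+* TateField Fq := (algebraMap (Tate Fq) (TateField Fq)).comp (Tate.const Fq)

/-- The variable `t`, as an element of `𝕃`. -/
def t : TateField Fq := algebraMap (Tate Fq) (TateField Fq) (Tate.t Fq)

/-- `Fq(t)`, as a subfield of `𝕃`. -/
def ratF : Subfield (TateField Fq) :=
  Subfield.closure (insert (t Fq) (Set.range fun a : Fq => const Fq (algebraMap Fq (CInf Fq) a)))

/-- `k̄(t)`, as a subfield of `𝕃`. -/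
def ratKBar : Subfield (TateField Fq) :=
  Subfield.closure (insert (t Fq) (Set.range fun a : KBar Fq => const Fq (a : CInf Fq)))

end TateField

end Tate

/-! ### Difference Galois groups

Here `F` and `K` are subfields of a field `L`, given through algebra structures on `L`. -/

section Galois

open TensorProduct

/-- `F[X, 1 / det X]`, the coordinate ring of `GL_r` over `F`. -/
abbrev GLRing (F : Type*) [CommRing F] (r : ℕ) : Type _ :=
  Localization.Away (Matrix.mvPolynomialX (Fin r) (Fin r) F).det

/-- The `F`-algebra map `F[X, 1 / det X] → A` with `X ↦ M`, for `M ∈ GL_r(A)`. -/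
def GLRing.eval (F : Type*) [CommRing F] {r : ℕ} {A : Type*} [CommRing A] [Algebra F A]
    (M : GL (Fin r) A) : GLRing F r →ₐ[F] A :=
  IsLocalization.liftAlgHom
    (M := Submonoid.powers (Matrix.mvPolynomialX (Fin r) (Fin r) F).det)
    (f := MvPolynomial.aeval fun ij : Fin r × Fin r => (M : Matrix (Fin r) (Fin r) A) ij.1 ij.2) <| by
    rintro ⟨_, n, rfl⟩
    have h : MvPolynomial.aeval (fun ij : Fin r × Fin r => (M : Matrix (Fin r) (Fin r) A) ij.1 ij.2)
        (Matrix.mvPolynomialX (Fin r) (Fin r) F).det = (M : Matrix (Fin r) (Fin r) A).det := by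
      rw [AlgHom.map_det]
      congr 1
      exact Matrix.mvPolynomialX_mapMatrix_aeval F (M : Matrix (Fin r) (Fin r) A)
    simp only [map_pow]
    rw [h]
    exact ((Matrix.isUnit_iff_isUnit_det _).1 M.isUnit).pow n

variable (F K : Type*) {L : Type*} [Field F] [Field K] [Field L] [Algebra F L] [Algebra K L] {r : ℕ}

/-- `Ψ̃ = Ψ₁⁻¹ Ψ₂ ∈ GL_r(L ⊗_K L)`, where `Ψ₁ = Ψ ⊗ 1` and `Ψ₂ = 1 ⊗ Ψ`. -/
def psiTilde (Ψ : GL (Fin r) L) : GL (Fin r) (L ⊗[K] L) :=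
  (Matrix.GeneralLinearGroup.map (Algebra.TensorProduct.includeLeftRingHom : L →+* L ⊗[K] L) Ψ)⁻¹ *
    Matrix.GeneralLinearGroup.map
      ((Algebra.TensorProduct.includeRight : L →ₐ[K] L ⊗[K] L) : L →+* L ⊗[K] L) Ψ

/-- The coordinate ring `Δ` of the difference Galois group `Γ_Ψ = Spec Δ` over `F`: the image of
the `F`-algebra map `μ : F[X, 1 / det X] → L ⊗_K L`, `X ↦ Ψ̃`. -/
def galoisRing (Ψ : GL (Fin r) L) : Subalgebra F (L ⊗[K] L) :=
  (GLRing.eval F (psiTilde K Ψ)).range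

/-- The field `Λ = K(Ψ)` generated over `K` by the entries of `Ψ`. -/
def solutionField (Ψ : GL (Fin r) L) : IntermediateField K L :=
  IntermediateField.adjoin K
    (Set.range fun ij : Fin r × Fin r => (Ψ : Matrix (Fin r) (Fin r) L) ij.1 ij.2)

end Galois

end TMotive

end

/-!
# Fields of solutions and difference Galois groups of Frobenius difference equations

Write `F = Fq(t)`, `K = k̄(t)` and `L = 𝕃`. The field of constants of `σ` on `L` is `F`
(`TateField.mem_ratF_of_sigma_eq`): a fixed quotient of restricted power series has Laurent
coefficients in `Fq`, and a suitable `Fq`-linear functional on `𝕂` turns both series into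
polynomials over `Fq` with the same quotient.

**Algebraic closedness.** The elements of `Λ = K(Ψ)` that are algebraic over `K` form a finite
extension `E` of `K` (`finiteDimensional_algebraicClosure`), and `E` is stable under `σ` because
`Λ` is. Let `V_N ⊆ E` be the space of elements that are integral over `k̄[t]` and become integral
over `k̄[1/t]` after division by `t ^ N`; every element of `E` has a multiple by a polynomial in
`t` that lies in some `V_N`. Elements of `V_N` are power series in `t` with coefficients
in `k̄`. The constant coefficient of the minimal polynomial of `y ∈ V_N` over `K` is a polynomial
in `t` of degree at most `N [E : K]` which is divisible by `y`, so a nonzero `y` cannot vanish at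
`t = 0` to a higher order. Hence finitely many Taylor coefficients determine the elements of
`V_N`, and they are compatible with `σ`. If finitely many coordinates of a space with a semilinear
map are so, then the space is spanned by fixed vectors (`le_span_fixed`). As the fixed vectors
lie in `F`, it follows that `V_N ⊆ K` and `E = K` (`eq_bot_of_stable`).

**Smoothness.** The matrix `Ψ₁⁻¹ Ψ₂` is fixed by `σ ⊗ σ`, and elements that are linearly
independent over the constants `F` stay independent over `L` in a ring in which they are fixed by
an extension of `σ`; so `L ⊗_F Δ → L ⊗_K L` is injective (`galoisRing.lift_val_injective`). The
cocycle identity between the three copies of `Ψ` in `L ⊗_K L ⊗_K L` then gives a comultiplication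
on `Δ` (`galoisRing.exists_comul`), and hence translations by the points of `Γ` over an
algebraically closed field `Ω`, which act transitively on these points
(`exists_algEquiv_of_comul`). A reduced algebra of finite type over `Ω` is smooth at some point,
so `Γ` is smooth at all of them as soon as `Ω ⊗_F Δ` is reduced. Reducedness, in turn, holds as
the powers `1, t, …, t ^ (q - 1)` are linearly independent over the `q`-th powers of
`L`, as the orders of vanishing at `t = 0` show, while they span `F` and `K` over their `q`-th
powers. This independence is inherited by `L ⊗_K L`, so by `Δ`, which is therefore geometrically
reduced (`isReduced_tensorProduct_subalgebra`).
-/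


open scoped TensorProduct

namespace TMotive

/-! ### Smoothness of homogeneous schemes, and linear independence over constants -/

section Smooth

/-- A finite type algebra over an algebraically closed field whose automorphisms act transitively
on its rational points is smooth as soon as it is reduced: the smooth locus is open, it contains
the minimal primes, hence a closed point, hence all closed points. -/
theorem smooth_of_forall_exists_algEquiv {Ω A : Type*} [Field Ω] [IsAlgClosed Ω] [CommRing A]
    [Algebra Ω A] [Algebra.FiniteType Ω A] [IsReduced A]
    (h : ∀ c c' : A →ₐ[Ω] Ω, ∃ τ : A ≃ₐ[Ω] A, ∀ a, c' (τ a) = c a) :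
    Algebra.Smooth Ω A := by
  have : Algebra.FinitePresentation Ω A := Algebra.FinitePresentation.of_finiteType.1 inferInstance
  have : IsNoetherianRing A := Algebra.FiniteType.isNoetherianRing Ω A
  have : IsJacobsonRing A := isJacobsonRing_of_finiteType (A := Ω)
  refine ⟨(Algebra.smoothLocus_eq_univ_iff).1 (Set.eq_univ_iff_forall.2 fun p => ?_), inferInstance⟩
  have : Nontrivial A := p.nontrivial
  obtain ⟨P, hP⟩ := Ideal.nonempty_minimalPrimes (I := (⊥ : Ideal A)) bot_ne_top
  have hPp : P.IsPrime := hP.1.1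
  -- the local ring of a reduced ring at a minimal prime is a field
  have hfield : IsField (Localization.AtPrime P) := by
    have : Ring.KrullDimLE 0 (Localization.AtPrime P) := .of_isLocalization _ hP _
    have : IsReduced (Localization.AtPrime P) := inferInstance
    exact Ring.KrullDimLE.isField_of_isReduced
  have hPs : Algebra.IsSmoothAt Ω P := by
    let := hfield.toField
    have : Algebra.EssFiniteType Ω (Localization.AtPrime P) :=
      Algebra.EssFiniteType.comp Ω A (Localization.AtPrime P)
    exact Algebra.FormallySmooth.of_perfectField
  obtain ⟨f, hfP, hf⟩ := Algebra.IsSmoothAt.exists_notMem_smooth Ω P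
  have hloc := Algebra.basicOpen_subset_smoothLocus_iff_smooth.2 hf
  -- every maximal ideal is the kernel of a rational point
  have hpt : ∀ m : Ideal A, m.IsMaximal → ∃ c : A →ₐ[Ω] Ω, ∀ a, a ∈ m ↔ c a = 0 := by
    intro m hm
    let := Ideal.Quotient.field m
    have : Algebra.FiniteType Ω (A ⧸ m) :=
      Algebra.FiniteType.of_surjective (Ideal.Quotient.mkₐ Ω m) Ideal.Quotient.mk_surjective
    have : Module.Finite Ω (A ⧸ m) := finite_of_finite_type_of_isJacobsonRing Ω (A ⧸ m)
    let e : Ω ≃ₐ[Ω] (A ⧸ m) := AlgEquiv.ofBijective (Algebra.ofId Ω (A ⧸ m))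
      IsAlgClosed.algebraMap_bijective_of_isIntegral
    refine ⟨e.symm.toAlgHom.comp (Ideal.Quotient.mkₐ Ω m), fun a => ?_⟩
    simp [Ideal.Quotient.eq_zero_iff_mem]
  obtain ⟨m₀, hm₀, hfm₀⟩ : ∃ m : Ideal A, m.IsMaximal ∧ f ∉ m := by
    by_contra! hcon
    have h1 : f ∈ (⊥ : Ideal A).jacobson :=
      Ideal.mem_sInf.2 fun {J} hJ => hcon J hJ.2
    rw [← Ideal.radical_eq_jacobson] at h1
    exact hfP (hPp.radical_le_iff.2 bot_le h1)
  have hm₀s : Algebra.IsSmoothAt Ω m₀ := hloc (a := ⟨m₀, hm₀.isPrime⟩) hfm₀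
  have hmax : ∀ m : Ideal A, ∀ hm : m.IsMaximal,
      (⟨m, hm.isPrime⟩ : PrimeSpectrum A) ∈ Algebra.smoothLocus Ω A := by
    intro m hm
    obtain ⟨c₀, hc₀⟩ := hpt m₀ hm₀
    obtain ⟨c, hc⟩ := hpt m hm
    obtain ⟨τ, hτ⟩ := h c c₀
    have hcomap : m = m₀.comap (τ : A ≃ₐ[Ω] A).toRingEquiv := by
      ext a
      rw [hc, Ideal.mem_comap, hc₀]
      exact (congrArg (· = 0) (hτ a)).symm.to_iff
    exact Algebra.FormallySmooth.of_equiv (Localization.localAlgEquiv m m₀ τ hcomap).symm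
  obtain ⟨m, hm, hpm⟩ := p.asIdeal.exists_le_maximal p.isPrime.ne_top
  by_contra hp
  have hcl : IsClosed (Algebra.smoothLocus Ω A)ᶜ := Algebra.isOpen_smoothLocus.isClosed_compl
  have hspec : p ⤳ (⟨m, hm.isPrime⟩ : PrimeSpectrum A) :=
    (PrimeSpectrum.le_iff_specializes _ _).1 hpm
  exact hspec.mem_closed hcl hp (hmax m hm)

end Smooth

section ConstantsIndependence

/-- Vectors fixed by a semilinear map and linearly independent over the field of constants are
linearly independent. -/
theorem linearIndependent_of_fixed {F L B ι : Type*} [Field F] [Field L] [Algebra F L]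
    [AddCommGroup B] [Module F B] [Module L B] [IsScalarTower F L B] (σ : L →+* L)
    (hσ : ∀ a : L, σ a = a → a ∈ (algebraMap F L).range) (S : B →+ B)
    (hS : ∀ (a : L) (b : B), S (a • b) = σ a • S b) {v : ι → B} (hv : ∀ i, S (v i) = v i)
    (hlin : LinearIndependent F v) : LinearIndependent L v := by
  classical
  rw [linearIndependent_iff']
  intro s
  induction s using Finset.induction_on with
  | empty => simp
  | insert j s hj ih =>
    intro g hg
    suffices hgj : g j = 0 by
      rw [Finset.sum_insert hj, hgj, zero_smul, zero_add] at hg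
      intro i hi
      rcases Finset.mem_insert.1 hi with rfl | hi
      · exact hgj
      · exact ih g hg i hi
    by_contra hne
    set g' : ι → L := fun i => (g j)⁻¹ * g i with hg'
    have hsum : v j + ∑ i ∈ s, g' i • v i = 0 := by
      have := congrArg ((g j)⁻¹ • ·) hg
      simpa [Finset.sum_insert hj, Finset.smul_sum, smul_smul, hne, hg'] using this
    have hsumS : v j + ∑ i ∈ s, σ (g' i) • v i = 0 := by
      simpa [hS, hv] using congrArg S hsum
    have hdiff : ∑ i ∈ s, (σ (g' i) - g' i) • v i = 0 := by
      simp only [sub_smul, Finset.sum_sub_distrib]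
      rw [sub_eq_zero]
      exact add_left_cancel (hsumS.trans hsum.symm)
    have hfix : ∀ i ∈ s, ∃ c : F, algebraMap F L c = g' i := fun i hi =>
      hσ _ (sub_eq_zero.1 (ih _ hdiff i hi))
    choose! c hc using hfix
    have hF : ∑ i ∈ insert j s, (Function.update c j 1) i • v i = 0 := by
      rw [Finset.sum_insert hj, Function.update_self, one_smul, ← hsum]
      congr 1
      refine Finset.sum_congr rfl fun i hi => ?_
      rw [Function.update_of_ne (by rintro rfl; exact hj hi), ← hc i hi, algebraMap_smul]
    have := (linearIndependent_iff'.1 hlin) _ _ hF j (Finset.mem_insert_self _ _)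
    simp at this

end ConstantsIndependence

/-! ### The coordinate ring of the general linear group, and threefold tensor products -/

section GLRing

variable {F : Type*} [Field F] {r : ℕ} {A A' : Type*} [CommRing A] [Algebra F A]
  [CommRing A'] [Algebra F A']

/-- The universal matrix `X ∈ GL_r(F[X, 1 / det X])`. -/
noncomputable def GLRing.univ (F : Type*) [Field F] (r : ℕ) : GL (Fin r) (GLRing F r) :=
  Matrix.GeneralLinearGroup.mk'' ((Matrix.mvPolynomialX (Fin r) (Fin r) F).map
      (algebraMap (MvPolynomial (Fin r × Fin r) F) (GLRing F r))) <| by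
    have := IsLocalization.Away.algebraMap_isUnit (S := GLRing F r)
      (Matrix.mvPolynomialX (Fin r) (Fin r) F).det
    rwa [RingHom.map_det] at this

theorem GLRing.univ_apply (i j : Fin r) :
    (GLRing.univ F r : Matrix (Fin r) (Fin r) (GLRing F r)) i j =
      algebraMap (MvPolynomial (Fin r × Fin r) F) (GLRing F r) (MvPolynomial.X (i, j)) := by
  simp [GLRing.univ, Matrix.GeneralLinearGroup.mk'', Matrix.nonsingInvUnit]

theorem GLRing.eval_algebraMap (M : GL (Fin r) A) (p : MvPolynomial (Fin r × Fin r) F) :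
    GLRing.eval F M (algebraMap _ (GLRing F r) p) =
      MvPolynomial.aeval
        (fun ij : Fin r × Fin r => (M : Matrix (Fin r) (Fin r) A) ij.1 ij.2) p := by
  simp [GLRing.eval]

theorem GLRing.map_eval_univ (M : GL (Fin r) A) :
    Matrix.GeneralLinearGroup.map (GLRing.eval F M : GLRing F r →+* A) (GLRing.univ F r) = M := by
  ext i j
  rw [Matrix.GeneralLinearGroup.map_apply, GLRing.univ_apply]
  exact (GLRing.eval_algebraMap M _).trans (MvPolynomial.aeval_X _ _)

theorem GLRing.algHom_ext {f g : GLRing F r →ₐ[F] A}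
    (h : Matrix.GeneralLinearGroup.map (f : GLRing F r →+* A) (GLRing.univ F r) =
      Matrix.GeneralLinearGroup.map (g : GLRing F r →+* A) (GLRing.univ F r)) : f = g := by
  apply IsLocalization.algHom_ext
    (Submonoid.powers (Matrix.mvPolynomialX (Fin r) (Fin r) F).det)
  apply MvPolynomial.algHom_ext
  intro ij
  have h1 := congrArg (fun M : GL (Fin r) A => (M : Matrix (Fin r) (Fin r) A) ij.1 ij.2) h
  simp only [Matrix.GeneralLinearGroup.map_apply, GLRing.univ_apply] at h1
  exact h1

theorem GLRing.comp_eval (f : A →ₐ[F] A') (M : GL (Fin r) A) :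
    f.comp (GLRing.eval F M) =
      GLRing.eval F (Matrix.GeneralLinearGroup.map (f : A →+* A') M) := by
  apply GLRing.algHom_ext
  rw [GLRing.map_eval_univ]
  conv_rhs => rw [← GLRing.map_eval_univ (F := F) M]
  rfl

theorem GLRing.apply_eval (f : A →ₐ[F] A') (M : GL (Fin r) A) (P : GLRing F r) :
    f (GLRing.eval F M P) =
      GLRing.eval F (Matrix.GeneralLinearGroup.map (f : A →+* A') M) P :=
  DFunLike.congr_fun (GLRing.comp_eval f M) P

end GLRing

section Hopf

variable {F K L : Type*} [Field F] [Field K] [Field L] [Algebra F K] [Algebra F L] [Algebra K L]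
  [IsScalarTower F K L] {r : ℕ}

/-- If the elements of a subalgebra `D` of `L ⊗[K] L` are fixed by `σ ⊗ σ` and the field of
constants of `σ` is `F`, then `L` and `D` are linearly disjoint over `F`. -/
theorem lift_val_injective_of_fixed (σ : L →+* L)
    (hσ : ∀ a : L, σ a = a → a ∈ (algebraMap F L).range) (S : L ⊗[K] L →+* L ⊗[K] L)
    (hS : ∀ a b : L, S (a ⊗ₜ b) = σ a ⊗ₜ σ b) (D : Subalgebra F (L ⊗[K] L))
    (hD : ∀ d ∈ D, S d = d) :
    Function.Injective
      (Algebra.TensorProduct.lift (Algebra.ofId L (L ⊗[K] L)) D.val fun _ _ => .all _ _ :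
        L ⊗[F] D →ₐ[L] L ⊗[K] L) := by
  let δ := Module.Basis.ofVectorSpace F D
  have hv : LinearIndependent L (fun i => (δ i : L ⊗[K] L)) := by
    refine linearIndependent_of_fixed (F := F) σ hσ S.toAddMonoidHom (fun a b => ?_)
      (fun i => hD _ (δ i).2)
      (δ.linearIndependent.map' D.val.toLinearMap (LinearMap.ker_eq_bot.2 Subtype.val_injective))
    have h1 : ∀ x : L, x • (1 : L ⊗[K] L) = x ⊗ₜ 1 := fun x => by
      rw [Algebra.TensorProduct.one_def, TensorProduct.smul_tmul', smul_eq_mul, mul_one]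
    change S (a • b) = σ a • S b
    rw [← one_mul b, ← smul_mul_assoc, h1, map_mul, hS, map_one, map_mul, map_one, one_mul,
      ← h1, smul_mul_assoc, one_mul]
  let Δb := Algebra.TensorProduct.basis L δ
  have hb : ∀ i, (Algebra.TensorProduct.lift (Algebra.ofId L (L ⊗[K] L)) D.val
      (fun _ _ => .all _ _) : L ⊗[F] D →ₐ[L] L ⊗[K] L).toLinearMap (Δb i) = δ i := by
    intro i
    simp [Δb, ← Algebra.TensorProduct.one_def]
  refine (LinearMap.ker_eq_bot (f := (Algebra.TensorProduct.lift (Algebra.ofId L (L ⊗[K] L)) D.val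
      (fun _ _ => .all _ _) : L ⊗[F] D →ₐ[L] L ⊗[K] L).toLinearMap)).1 ?_
  refine LinearMap.ker_eq_bot'.2 fun x hx => ?_
  have h2 : (Finsupp.linearCombination L fun i => (δ i : L ⊗[K] L)) (Δb.repr x) = 0 := by
    rw [← hx]
    conv_rhs => rw [← Δb.linearCombination_repr x]
    rw [Finsupp.apply_linearCombination]
    congr 2
    funext i
    exact (hb i).symm
  have h3 := (linearIndependent_iff.1 hv) _ h2
  exact Δb.repr.map_eq_zero_iff.1 h3

variable (F K) in
/-- The map `x ↦ x ⊗ 1` onto the first two factors of `L ⊗[K] L ⊗[K] L`. -/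
noncomputable def incl₁₂ (L : Type*) [Field L] [Algebra F L] [Algebra K L] [IsScalarTower F K L] :
    L ⊗[K] L →ₐ[F] L ⊗[K] (L ⊗[K] L) :=
  (Algebra.TensorProduct.map (AlgHom.id K L)
    (Algebra.TensorProduct.includeLeft : L →ₐ[K] L ⊗[K] L)).restrictScalars F

variable (F K) in
/-- The map onto the outer two factors of `L ⊗[K] L ⊗[K] L`. -/
noncomputable def incl₁₃ (L : Type*) [Field L] [Algebra F L] [Algebra K L] [IsScalarTower F K L] :
    L ⊗[K] L →ₐ[F] L ⊗[K] (L ⊗[K] L) :=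
  (Algebra.TensorProduct.map (AlgHom.id K L)
    (Algebra.TensorProduct.includeRight : L →ₐ[K] L ⊗[K] L)).restrictScalars F

variable (F K) in
/-- The map `x ↦ 1 ⊗ x` onto the last two factors of `L ⊗[K] L ⊗[K] L`. -/
noncomputable def incl₂₃ (L : Type*) [Field L] [Algebra F L] [Algebra K L] [IsScalarTower F K L] :
    L ⊗[K] L →ₐ[F] L ⊗[K] (L ⊗[K] L) :=
  (Algebra.TensorProduct.includeRight : L ⊗[K] L →ₐ[K] L ⊗[K] (L ⊗[K] L)).restrictScalars F

/-- If `L` and `D` are linearly disjoint over `F` in `L ⊗[K] L`, then so are the copies of `D`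
in the first two and in the last two factors of `L ⊗[K] L ⊗[K] L`. -/
theorem productMap_incl_injective (D : Subalgebra F (L ⊗[K] L))
    (hinj : Function.Injective
      (Algebra.TensorProduct.lift (Algebra.ofId L (L ⊗[K] L)) D.val fun _ _ => .all _ _ :
        L ⊗[F] D →ₐ[L] L ⊗[K] L)) :
    Function.Injective (Algebra.TensorProduct.productMap
      ((incl₁₂ F K L).comp D.val) ((incl₂₃ F K L).comp D.val)) := by
  let m : L ⊗[F] D →ₗ[K] L ⊗[K] L := ((Algebra.TensorProduct.lift (Algebra.ofId L (L ⊗[K] L)) D.val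
    fun _ _ => .all _ _ : L ⊗[F] D →ₐ[L] L ⊗[K] L).toLinearMap).restrictScalars K
  have hm : ∀ (a : L) (d : D), m (a ⊗ₜ d) = a ⊗ₜ[K] (1 : L) * d := fun a d => by
    change (Algebra.TensorProduct.lift (Algebra.ofId L (L ⊗[K] L)) D.val
      (fun _ _ => .all _ _) : L ⊗[F] D →ₐ[L] L ⊗[K] L) (a ⊗ₜ d) = _
    rw [Algebra.TensorProduct.lift_tmul]
    rfl
  have h1 : Function.Injective (D.val.toLinearMap.rTensor D) :=
    Module.Flat.rTensor_preserves_injective_linearMap _ Subtype.val_injective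
  have h2 : Function.Injective (m.lTensor L) :=
    Module.Flat.lTensor_preserves_injective_linearMap _ hinj
  clear_value m
  let e : (L ⊗[K] L) ⊗[F] D ≃ₗ[K] L ⊗[K] (L ⊗[F] D) :=
    TensorProduct.AlgebraTensorModule.assoc F K K L L D
  have he : ∀ (a b : L) (d : D), e ((a ⊗ₜ b) ⊗ₜ d) = a ⊗ₜ (b ⊗ₜ d) := fun _ _ _ => rfl
  clear_value e
  have key' : ∀ (b : L ⊗[K] L) (d : D), incl₁₂ F K L b * incl₂₃ F K L d =
      m.lTensor L (e (b ⊗ₜ d)) := by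
    intro b d
    induction b with
    | zero =>
      rw [TensorProduct.zero_tmul, LinearEquiv.map_zero, LinearMap.map_zero, map_zero, zero_mul]
    | add x y hx hy =>
      rw [TensorProduct.add_tmul, LinearEquiv.map_add, LinearMap.map_add, map_add, add_mul, hx, hy]
    | tmul x y =>
      rw [he, LinearMap.lTensor_tmul, hm]
      change (x ⊗ₜ[K] (y ⊗ₜ[K] (1 : L))) * ((1 : L) ⊗ₜ[K] (d : L ⊗[K] L)) = _
      rw [Algebra.TensorProduct.tmul_mul_tmul, mul_one]
  have key : ∀ z, Algebra.TensorProduct.productMap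
      ((incl₁₂ F K L).comp D.val) ((incl₂₃ F K L).comp D.val) z =
      m.lTensor L (e (D.val.toLinearMap.rTensor D z)) := by
    intro z
    induction z with
    | zero => rw [map_zero, LinearMap.map_zero, LinearEquiv.map_zero, LinearMap.map_zero]
    | add x y hx hy =>
      rw [map_add, LinearMap.map_add, LinearEquiv.map_add, LinearMap.map_add, hx, hy]
    | tmul x y =>
      rw [Algebra.TensorProduct.productMap_apply_tmul, LinearMap.rTensor_tmul]
      exact key' x y
  intro x y hxy
  rw [key, key] at hxy
  exact h1 (e.injective (h2 hxy))

end Hopf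

/-! ### Points of the difference Galois group -/

section Translations

variable {F K L : Type*} [Field F] [Field K] [Field L] [Algebra F K] [Algebra F L] [Algebra K L]
  [IsScalarTower F K L] {r : ℕ}

variable (F K) in
/-- The quotient map `F[X, 1 / det X] → Δ`. -/
noncomputable def galoisRing.proj (Ψ : GL (Fin r) L) : GLRing F r →ₐ[F] galoisRing F K Ψ :=
  (GLRing.eval F (psiTilde K Ψ)).rangeRestrict

variable (F K) in
/-- The tautological `Δ`-point of `Γ`, that is, `Ψ̃` as a matrix over `Δ`. -/
noncomputable def galoisRing.point (Ψ : GL (Fin r) L) : GL (Fin r) (galoisRing F K Ψ) :=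
  Matrix.GeneralLinearGroup.map (galoisRing.proj F K Ψ : GLRing F r →+* galoisRing F K Ψ)
    (GLRing.univ F r)

theorem galoisRing.proj_surjective (Ψ : GL (Fin r) L) :
    Function.Surjective (galoisRing.proj F K Ψ) :=
  AlgHom.rangeRestrict_surjective _

theorem galoisRing.map_val_point (Ψ : GL (Fin r) L) :
    Matrix.GeneralLinearGroup.map ((galoisRing F K Ψ).val : galoisRing F K Ψ →+* L ⊗[K] L)
      (galoisRing.point F K Ψ) = psiTilde K Ψ :=
  GLRing.map_eval_univ (F := F) (psiTilde K Ψ)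

theorem galoisRing.proj_eq_eval (Ψ : GL (Fin r) L) :
    galoisRing.proj F K Ψ = GLRing.eval F (galoisRing.point F K Ψ) :=
  GLRing.algHom_ext (GLRing.map_eval_univ _).symm

variable {A : Type*} [CommRing A] [Algebra F A]

/-- A matrix `M ∈ GL_r(A)` is an `A`-point of `Γ` as soon as the relations satisfied by `Ψ̃`
are satisfied by `M`. -/
theorem galoisRing.exists_algHom {Ψ : GL (Fin r) L} (M : GL (Fin r) A)
    (h : ∀ P : GLRing F r, GLRing.eval F (psiTilde K Ψ) P = 0 → GLRing.eval F M P = 0) :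
    ∃ f : galoisRing F K Ψ →ₐ[F] A,
      Matrix.GeneralLinearGroup.map (f : galoisRing F K Ψ →+* A) (galoisRing.point F K Ψ) = M := by
  have hker : ∀ P ∈ RingHom.ker (galoisRing.proj F K Ψ), GLRing.eval F M P = 0 := fun P hP =>
    h P (congrArg Subtype.val ((RingHom.mem_ker).1 hP))
  let f : galoisRing F K Ψ →ₐ[F] A :=
    AlgHom.liftOfSurjective _ (galoisRing.proj_surjective Ψ) (GLRing.eval F M) hker
  have hf : ∀ P, f (galoisRing.proj F K Ψ P) = GLRing.eval F M P :=
    AlgHom.liftOfSurjective_apply _ _ _ _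
  refine ⟨f, ?_⟩
  conv_rhs => rw [← GLRing.map_eval_univ (F := F) M]
  ext i j
  exact hf _

/-- The neutral element of `Γ`. -/
theorem galoisRing.exists_counit (Ψ : GL (Fin r) L) :
    ∃ e : galoisRing F K Ψ →ₐ[F] F,
      Matrix.GeneralLinearGroup.map (e : galoisRing F K Ψ →+* F) (galoisRing.point F K Ψ) = 1 := by
  refine galoisRing.exists_algHom 1 fun P hP => ?_
  let m : L ⊗[K] L →ₐ[F] L := (Algebra.TensorProduct.lmul' K (S := L)).restrictScalars F
  have h1 : Matrix.GeneralLinearGroup.map (m : L ⊗[K] L →+* L) (psiTilde K Ψ) = 1 := by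
    rw [psiTilde, map_mul, map_inv, inv_mul_eq_one]
    ext i j
    simp [m]
  have h2 := GLRing.apply_eval m (psiTilde K Ψ) P
  rw [hP, map_zero, h1] at h2
  have h3 := GLRing.apply_eval (Algebra.ofId F L) (1 : GL (Fin r) F) P
  rw [map_one, ← h2] at h3
  exact (algebraMap F L).injective (h3.trans (map_zero _).symm)

/-- The inversion of `Γ`, induced by exchanging the two factors of `L ⊗[K] L`. -/
theorem galoisRing.exists_antipode (Ψ : GL (Fin r) L) :
    ∃ s : galoisRing F K Ψ →ₐ[F] galoisRing F K Ψ,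
      Matrix.GeneralLinearGroup.map (s : galoisRing F K Ψ →+* galoisRing F K Ψ)
        (galoisRing.point F K Ψ) = (galoisRing.point F K Ψ)⁻¹ := by
  refine galoisRing.exists_algHom _ fun P hP => ?_
  let c : L ⊗[K] L →ₐ[F] L ⊗[K] L :=
    (Algebra.TensorProduct.comm K L L).toAlgHom.restrictScalars F
  have h1 : Matrix.GeneralLinearGroup.map (c : L ⊗[K] L →+* L ⊗[K] L) (psiTilde K Ψ) =
      (psiTilde K Ψ)⁻¹ := by
    rw [psiTilde, map_mul, map_inv, mul_inv_rev, inv_inv]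
    congr 1
  have h2 := GLRing.apply_eval c (psiTilde K Ψ) P
  rw [hP, map_zero, h1, ← galoisRing.map_val_point (F := F), ← map_inv, ← GLRing.apply_eval] at h2
  exact Subtype.ext h2.symm

/-- The multiplication of `Γ`. On `L ⊗[K] L ⊗[K] L` it expresses the cocycle relation
`(Ψ₁⁻¹ Ψ₂) (Ψ₂⁻¹ Ψ₃) = Ψ₁⁻¹ Ψ₃`. -/
theorem galoisRing.exists_comul (Ψ : GL (Fin r) L)
    (hinj : Function.Injective
      (Algebra.TensorProduct.lift (Algebra.ofId L (L ⊗[K] L)) (galoisRing F K Ψ).val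
        fun _ _ => .all _ _ : L ⊗[F] galoisRing F K Ψ →ₐ[L] L ⊗[K] L)) :
    ∃ c : galoisRing F K Ψ →ₐ[F] galoisRing F K Ψ ⊗[F] galoisRing F K Ψ,
      Matrix.GeneralLinearGroup.map
          (c : galoisRing F K Ψ →+* galoisRing F K Ψ ⊗[F] galoisRing F K Ψ)
          (galoisRing.point F K Ψ) =
        Matrix.GeneralLinearGroup.map (S := galoisRing F K Ψ ⊗[F] galoisRing F K Ψ)
          ((Algebra.TensorProduct.includeLeft : galoisRing F K Ψ →ₐ[F]
            galoisRing F K Ψ ⊗[F] galoisRing F K Ψ) :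
            galoisRing F K Ψ →+* galoisRing F K Ψ ⊗[F] galoisRing F K Ψ)
          (galoisRing.point F K Ψ) *
        Matrix.GeneralLinearGroup.map (S := galoisRing F K Ψ ⊗[F] galoisRing F K Ψ)
          ((Algebra.TensorProduct.includeRight : galoisRing F K Ψ →ₐ[F]
            galoisRing F K Ψ ⊗[F] galoisRing F K Ψ) :
            galoisRing F K Ψ →+* galoisRing F K Ψ ⊗[F] galoisRing F K Ψ)
          (galoisRing.point F K Ψ) := by
  apply galoisRing.exists_algHom (F := F) (K := K) (Ψ := Ψ)
    (A := galoisRing F K Ψ ⊗[F] galoisRing F K Ψ)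
  intro P hP
  let m : galoisRing F K Ψ ⊗[F] galoisRing F K Ψ →ₐ[F] L ⊗[K] (L ⊗[K] L) :=
    Algebra.TensorProduct.productMap
      ((incl₁₂ F K L).comp (galoisRing F K Ψ).val) ((incl₂₃ F K L).comp (galoisRing F K Ψ).val)
  have hm : Function.Injective m := productMap_incl_injective (galoisRing F K Ψ) hinj
  refine hm ?_
  rw [map_zero]
  refine (GLRing.apply_eval (A := galoisRing F K Ψ ⊗[F] galoisRing F K Ψ)
    (A' := L ⊗[K] (L ⊗[K] L)) m _ P).trans ?_
  rw [map_mul]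
  have h1 := GLRing.apply_eval (incl₁₃ F K L) (psiTilde K Ψ) P
  rw [hP, map_zero] at h1
  rw [h1]
  congr 1
  congr 1
  have hl : Matrix.GeneralLinearGroup.map (S := L ⊗[K] (L ⊗[K] L))
      (m : galoisRing F K Ψ ⊗[F] galoisRing F K Ψ →+* L ⊗[K] (L ⊗[K] L))
        (Matrix.GeneralLinearGroup.map (S := galoisRing F K Ψ ⊗[F] galoisRing F K Ψ)
          ((Algebra.TensorProduct.includeLeft : galoisRing F K Ψ →ₐ[F]
            galoisRing F K Ψ ⊗[F] galoisRing F K Ψ) :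
            galoisRing F K Ψ →+* galoisRing F K Ψ ⊗[F] galoisRing F K Ψ)
          (galoisRing.point F K Ψ)) = Matrix.GeneralLinearGroup.map (S := L ⊗[K] (L ⊗[K] L))
            (incl₁₂ F K L : L ⊗[K] L →+* _) (psiTilde K Ψ) := by
    rw [← galoisRing.map_val_point (F := F)]
    ext i j
    simp [m]
  have hr : Matrix.GeneralLinearGroup.map (S := L ⊗[K] (L ⊗[K] L))
      (m : galoisRing F K Ψ ⊗[F] galoisRing F K Ψ →+* L ⊗[K] (L ⊗[K] L))
        (Matrix.GeneralLinearGroup.map (S := galoisRing F K Ψ ⊗[F] galoisRing F K Ψ)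
          ((Algebra.TensorProduct.includeRight : galoisRing F K Ψ →ₐ[F]
            galoisRing F K Ψ ⊗[F] galoisRing F K Ψ) :
            galoisRing F K Ψ →+* galoisRing F K Ψ ⊗[F] galoisRing F K Ψ)
          (galoisRing.point F K Ψ)) = Matrix.GeneralLinearGroup.map (S := L ⊗[K] (L ⊗[K] L))
            (incl₂₃ F K L : L ⊗[K] L →+* _) (psiTilde K Ψ) := by
    rw [← galoisRing.map_val_point (F := F)]
    ext i j
    simp [m]
  rw [hl, hr]
  simp only [psiTilde, map_mul, map_inv]
  have h12 : Matrix.GeneralLinearGroup.map (S := L ⊗[K] (L ⊗[K] L)) (incl₁₂ F K L : L ⊗[K] L →+* _)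
      (Matrix.GeneralLinearGroup.map
        ((Algebra.TensorProduct.includeRight : L →ₐ[K] L ⊗[K] L) : L →+* L ⊗[K] L) Ψ) =
      Matrix.GeneralLinearGroup.map (S := L ⊗[K] (L ⊗[K] L)) (incl₂₃ F K L : L ⊗[K] L →+* _)
      (Matrix.GeneralLinearGroup.map
        (Algebra.TensorProduct.includeLeftRingHom : L →+* L ⊗[K] L) Ψ) := by
    ext i j
    simp [incl₁₂, incl₂₃]
  rw [h12, mul_assoc, mul_inv_cancel_left]
  refine congrArg₂ (fun a b => a⁻¹ * b) ?_ ?_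
  · ext i j
    simp [incl₁₂, incl₁₃]
  · ext i j
    simp [incl₂₃, incl₁₃]

end Translations

/-! ### Translations of the difference Galois group -/

section TranslationAut

variable {F D Ω : Type*} [Field F] [CommRing D] [Algebra F D] [Field Ω] [Algebra F Ω] {r : ℕ}

theorem algHom_ext_of_eval_surjective {X : GL (Fin r) D}
    (hX : Function.Surjective (GLRing.eval F X)) {A : Type*} [CommRing A] [Algebra F A]
    {f g : D →ₐ[F] A}
    (h : Matrix.GeneralLinearGroup.map (f : D →+* A) X =
      Matrix.GeneralLinearGroup.map (g : D →+* A) X) : f = g := by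
  ext x
  obtain ⟨P, rfl⟩ := hX x
  rw [GLRing.apply_eval, GLRing.apply_eval, h]

/-- Let `D` be the coordinate ring of a closed subgroup of `GL_r`. The left translations by
`Ω`-points are automorphisms of `Ω ⊗[F] D`, and they act transitively on its `Ω`-points. -/
theorem exists_algEquiv_of_comul {X : GL (Fin r) D} (hX : Function.Surjective (GLRing.eval F X))
    (Δ : D →ₐ[F] D ⊗[F] D)
    (hΔ : Matrix.GeneralLinearGroup.map (Δ : D →+* D ⊗[F] D) X =
      Matrix.GeneralLinearGroup.map (S := D ⊗[F] D)
        ((Algebra.TensorProduct.includeLeft : D →ₐ[F] D ⊗[F] D) : D →+* D ⊗[F] D) X *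
      Matrix.GeneralLinearGroup.map (S := D ⊗[F] D)
        ((Algebra.TensorProduct.includeRight : D →ₐ[F] D ⊗[F] D) : D →+* D ⊗[F] D) X)
    (s : D →ₐ[F] D) (hs : Matrix.GeneralLinearGroup.map (s : D →+* D) X = X⁻¹)
    (e : D →ₐ[F] F) (he : Matrix.GeneralLinearGroup.map (e : D →+* F) X = 1)
    (c c' : Ω ⊗[F] D →ₐ[Ω] Ω) :
    ∃ τ : Ω ⊗[F] D ≃ₐ[Ω] Ω ⊗[F] D, ∀ a, c' (τ a) = c a := by
  let ι : D →ₐ[F] Ω ⊗[F] D := Algebra.TensorProduct.includeRight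
  let Y : GL (Fin r) (Ω ⊗[F] D) := Matrix.GeneralLinearGroup.map (ι : D →+* Ω ⊗[F] D) X
  let const : GL (Fin r) Ω →* GL (Fin r) (Ω ⊗[F] D) :=
    Matrix.GeneralLinearGroup.map (algebraMap Ω (Ω ⊗[F] D))
  -- `Ω`-algebra maps out of `Ω ⊗ D` are determined by the image of `X`
  have hext : ∀ f g : Ω ⊗[F] D →ₐ[Ω] Ω ⊗[F] D,
      Matrix.GeneralLinearGroup.map (f : Ω ⊗[F] D →+* Ω ⊗[F] D) Y =
      Matrix.GeneralLinearGroup.map (g : Ω ⊗[F] D →+* Ω ⊗[F] D) Y → f = g := fun f g h =>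
    Algebra.TensorProduct.ext_ring (algHom_ext_of_eval_surjective hX h)
  have hext' : ∀ f g : Ω ⊗[F] D →ₐ[Ω] Ω,
      Matrix.GeneralLinearGroup.map (f : Ω ⊗[F] D →+* Ω) Y =
      Matrix.GeneralLinearGroup.map (g : Ω ⊗[F] D →+* Ω) Y → f = g := fun f g h =>
    Algebra.TensorProduct.ext_ring (algHom_ext_of_eval_surjective hX h)
  -- the translation by the point `p`
  let T : (D →ₐ[F] Ω) → (Ω ⊗[F] D →ₐ[Ω] Ω ⊗[F] D) := fun p =>
    Algebra.TensorProduct.lift (Algebra.ofId Ω (Ω ⊗[F] D))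
      ((Algebra.TensorProduct.map p (AlgHom.id F D)).comp Δ) fun _ _ => .all _ _
  have hT : ∀ p, Matrix.GeneralLinearGroup.map (T p : Ω ⊗[F] D →+* Ω ⊗[F] D) Y =
      const (Matrix.GeneralLinearGroup.map (p : D →+* Ω) X) * Y := by
    intro p
    have h1 : Matrix.GeneralLinearGroup.map (T p : Ω ⊗[F] D →+* Ω ⊗[F] D) Y =
        Matrix.GeneralLinearGroup.map (S := Ω ⊗[F] D)
          ((Algebra.TensorProduct.map p (AlgHom.id F D) : D ⊗[F] D →ₐ[F] Ω ⊗[F] D) :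
            D ⊗[F] D →+* Ω ⊗[F] D) (Matrix.GeneralLinearGroup.map (Δ : D →+* D ⊗[F] D) X) := by
      ext i j
      simp [T, Y, ι, ← Algebra.TensorProduct.one_def]
    rw [h1, hΔ, map_mul]
    congr 1
    ext i j
    simp [Y, ι]
  have hconst : ∀ (f : Ω ⊗[F] D →ₐ[Ω] Ω ⊗[F] D) (M : GL (Fin r) Ω),
      Matrix.GeneralLinearGroup.map (f : Ω ⊗[F] D →+* Ω ⊗[F] D) (const M) = const M := by
    intro f M
    ext i j
    exact f.commutes (M i j)
  have hinv : ∀ p q : D →ₐ[F] Ω, Matrix.GeneralLinearGroup.map (q : D →+* Ω) X *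
      Matrix.GeneralLinearGroup.map (p : D →+* Ω) X = 1 → (T p).comp (T q) = AlgHom.id Ω _ := by
    intro p q hpq
    apply hext
    have h1 : Matrix.GeneralLinearGroup.map ((T p).comp (T q) : Ω ⊗[F] D →+* Ω ⊗[F] D) Y =
        Matrix.GeneralLinearGroup.map (T p : Ω ⊗[F] D →+* Ω ⊗[F] D)
          (Matrix.GeneralLinearGroup.map (T q : Ω ⊗[F] D →+* Ω ⊗[F] D) Y) := rfl
    refine h1.trans ?_
    rw [hT q, map_mul, hT p, hconst, ← mul_assoc, ← map_mul, hpq, map_one, one_mul]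
    rfl
  have hs' : ∀ p : D →ₐ[F] Ω, Matrix.GeneralLinearGroup.map (p.comp s : D →+* Ω) X =
      (Matrix.GeneralLinearGroup.map (p : D →+* Ω) X)⁻¹ := fun p => by
    rw [← map_inv, ← hs]
    rfl
  let E : (D →ₐ[F] Ω) → (Ω ⊗[F] D ≃ₐ[Ω] Ω ⊗[F] D) := fun p =>
    AlgEquiv.ofAlgHom (T p) (T (p.comp s)) (hinv _ _ (by rw [hs', inv_mul_cancel]))
      (hinv _ _ (by rw [hs', mul_inv_cancel]))
  let e' : Ω ⊗[F] D →ₐ[Ω] Ω := Algebra.TensorProduct.lift (AlgHom.id Ω Ω)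
    ((Algebra.ofId F Ω).comp e) fun _ _ => .all _ _
  have he' : Matrix.GeneralLinearGroup.map (e' : Ω ⊗[F] D →+* Ω) Y = 1 := by
    have h1 : Matrix.GeneralLinearGroup.map (e' : Ω ⊗[F] D →+* Ω) Y =
        Matrix.GeneralLinearGroup.map (algebraMap F Ω)
          (Matrix.GeneralLinearGroup.map (e : D →+* F) X) := by
      ext i j
      simp [e', Y, ι, Algebra.ofId_apply]
    rw [h1, he, map_one]
  -- translating the neutral element by `p` gives `p`
  have htrans : ∀ d : Ω ⊗[F] D →ₐ[Ω] Ω,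
      e'.comp (T ((d.restrictScalars F).comp ι)) = d := by
    intro d
    apply hext'
    have h1 : Matrix.GeneralLinearGroup.map
        (e'.comp (T ((d.restrictScalars F).comp ι)) : Ω ⊗[F] D →+* Ω) Y =
        Matrix.GeneralLinearGroup.map (e' : Ω ⊗[F] D →+* Ω)
          (Matrix.GeneralLinearGroup.map
            (T ((d.restrictScalars F).comp ι) : Ω ⊗[F] D →+* Ω ⊗[F] D) Y) := rfl
    refine h1.trans ?_
    rw [hT, map_mul, he', mul_one]
    ext i j
    simp [const, Y, e']
  refine ⟨(E ((c.restrictScalars F).comp ι)).trans (E ((c'.restrictScalars F).comp ι)).symm,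
    fun a => ?_⟩
  have h1 := DFunLike.congr_fun (htrans c') ((E ((c'.restrictScalars F).comp ι)).symm
    (E ((c.restrictScalars F).comp ι) a))
  have h2 : T ((c'.restrictScalars F).comp ι) ((E ((c'.restrictScalars F).comp ι)).symm
    (E ((c.restrictScalars F).comp ι) a)) = E ((c.restrictScalars F).comp ι) a :=
    (E ((c'.restrictScalars F).comp ι)).apply_symm_apply _
  rw [AlgHom.comp_apply, h2] at h1
  exact h1.symm.trans (DFunLike.congr_fun (htrans c) a)

end TranslationAut

section SmoothGalois

variable {F K L : Type*} [Field F] [Field K] [Field L] [Algebra F K] [Algebra F L] [Algebra K L]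
  [IsScalarTower F K L] {r : ℕ}

theorem galoisRing.finiteType (Ψ : GL (Fin r) L) : Algebra.FiniteType F (galoisRing F K Ψ) := by
  have : Algebra.FiniteType F (GLRing F r) :=
    .trans (S := MvPolynomial (Fin r × Fin r) F) inferInstance
      (have := IsLocalization.Away.finitePresentation (S := GLRing F r)
        (Matrix.mvPolynomialX (Fin r) (Fin r) F).det
       inferInstance)
  exact .of_surjective _ (galoisRing.proj_surjective Ψ)

/-- The difference Galois group is smooth as soon as it is geometrically reduced. -/
theorem galoisRing.smooth_of_isReduced (Ψ : GL (Fin r) L)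
    (hinj : Function.Injective
      (Algebra.TensorProduct.lift (Algebra.ofId L (L ⊗[K] L)) (galoisRing F K Ψ).val
        fun _ _ => .all _ _ : L ⊗[F] galoisRing F K Ψ →ₐ[L] L ⊗[K] L))
    (Ω : Type*) [Field Ω] [IsAlgClosed Ω] [Algebra F Ω] [IsReduced (Ω ⊗[F] galoisRing F K Ψ)] :
    Algebra.Smooth Ω (Ω ⊗[F] galoisRing F K Ψ) := by
  have := galoisRing.finiteType (F := F) (K := K) Ψ
  obtain ⟨Δ, hΔ⟩ := galoisRing.exists_comul Ψ hinj
  obtain ⟨s, hs⟩ := galoisRing.exists_antipode (F := F) (K := K) Ψ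
  obtain ⟨e, he⟩ := galoisRing.exists_counit (F := F) (K := K) Ψ
  refine smooth_of_forall_exists_algEquiv fun c c' => exists_algEquiv_of_comul
    (X := galoisRing.point F K Ψ) ?_ Δ hΔ s hs e he c c'
  rw [← galoisRing.proj_eq_eval]
  exact galoisRing.proj_surjective Ψ

end SmoothGalois

/-! ### Separability by means of Frobenius powers -/

section FrobeniusIndependence

/-- `1, t, …, t ^ (q - 1)` are linearly independent over the `q`-th powers. -/
def IsFrobeniusFree {R : Type*} [CommRing R] (q : ℕ) (t : R) : Prop :=
  ∀ y : Fin q → R, ∑ j : Fin q, t ^ (j : ℕ) * y j ^ q = 0 → ∀ j, y j = 0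

/-- `1, t, …, t ^ (q - 1)` generate the ring over the `q`-th powers. -/
def IsFrobeniusSpanning {R : Type*} [CommRing R] (q : ℕ) (t : R) : Prop :=
  ∀ a : R, ∃ y : Fin q → R, ∑ j : Fin q, t ^ (j : ℕ) * y j ^ q = a

variable {K L R : Type*} [Field K] [Field L] [CommRing R] [Algebra K L] [Algebra K R]
  (p n : ℕ)

/-- Raising to the power `q` preserves linear independence over `K`, if `K` is spanned by
`1, …, t ^ (q - 1)` over `K ^ q` and these elements are free over `R ^ q`. -/
theorem linearIndependent_pow_of_isFrobeniusFree [ExpChar R p] {t : K}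
    (hK : IsFrobeniusSpanning (p ^ n) t) (hR : IsFrobeniusFree (p ^ n) (algebraMap K R t))
    {ι : Type*} {v : ι → R} (hv : LinearIndependent K v) :
    LinearIndependent K fun i => v i ^ p ^ n := by
  rw [linearIndependent_iff'] at hv ⊢
  intro s g hg i hi
  choose c hc using fun i => hK (g i)
  have h1 : ∑ j : Fin (p ^ n), algebraMap K R t ^ (j : ℕ) * (∑ i ∈ s, c i j • v i) ^ p ^ n = 0 := by
    rw [← hg]
    simp only [sum_pow_char_pow, Finset.mul_sum]
    rw [Finset.sum_comm]
    refine Finset.sum_congr rfl fun i _ => ?_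
    conv_rhs => rw [← hc i]
    rw [Finset.sum_smul]
    refine Finset.sum_congr rfl fun j _ => ?_
    simp only [Algebra.smul_def, map_mul, map_pow, mul_pow, mul_assoc]
  have h2 : ∀ j, c i j = 0 := fun j => hv s (fun i => c i j) (hR _ h1 j) i hi
  have hq : p ^ n ≠ 0 := pow_ne_zero _ (expChar_pos R p).ne'
  rw [← hc i]
  refine Finset.sum_eq_zero fun j _ => ?_
  rw [h2, zero_pow hq, mul_zero]

/-- The `q`-th power of an element of `L ⊗[K] R`, in terms of its coordinates. -/
theorem tmul_pow_eq_linearCombination [ExpChar (L ⊗[K] R) p] {ι : Type*}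
    (b : Module.Basis ι K R) (x : L ⊗[K] R) :
    x ^ p ^ n = ((Algebra.TensorProduct.basis L b).repr x).sum fun i a =>
      a ^ p ^ n • ((1 : L) ⊗ₜ[K] (b i ^ p ^ n)) := by
  conv_lhs => rw [← (Algebra.TensorProduct.basis L b).linearCombination_repr x]
  rw [Finsupp.linearCombination_apply, Finsupp.sum, Finsupp.sum, sum_pow_char_pow]
  refine Finset.sum_congr rfl fun i _ => ?_
  rw [smul_pow, Algebra.TensorProduct.basis_apply, Algebra.TensorProduct.tmul_pow, one_pow]

theorem linearIndependent_one_tmul {ι : Type*} {v : ι → R} (hv : LinearIndependent K v) :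
    LinearIndependent L fun i => (1 : L) ⊗ₜ[K] v i := by
  have h := (Algebra.TensorProduct.basis L
    (Module.Basis.extend hv.linearIndepOn_id)).linearIndependent
  have h2 := h.comp (fun i : ι => ⟨v i, hv.linearIndepOn_id.subset_extend _ ⟨i, rfl⟩⟩)
    (fun i j hij => hv.injective (congrArg Subtype.val hij))
  convert h2 using 2 with i
  simp

variable [ExpChar (L ⊗[K] R) p]

/-- The base change of `R` to a field is reduced as soon as raising to the power `q` preserves
linear independence over `K`. -/
theorem isReduced_tensorProduct (hq : 1 < p ^ n) {ι : Type*} (b : Module.Basis ι K R)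
    (hb : LinearIndependent K fun i => b i ^ p ^ n) : IsReduced (L ⊗[K] R) := by
  rw [isReduced_iff_pow_one_lt _ hq]
  intro x hx
  rw [tmul_pow_eq_linearCombination p n b] at hx
  have hw := linearIndependent_iff'.1 (linearIndependent_one_tmul (L := L) hb) _ _ hx
  refine (Algebra.TensorProduct.basis L b).repr.map_eq_zero_iff.1 (Finsupp.ext fun i => ?_)
  by_contra hi
  exact hi (eq_zero_of_pow_eq_zero (hw i (Finsupp.mem_support_iff.2 hi)))

theorem IsFrobeniusFree.tensorProduct {t : L} (ht : IsFrobeniusFree (p ^ n) t) {ι : Type*}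
    (b : Module.Basis ι K R) (hb : LinearIndependent K fun i => b i ^ p ^ n) :
    IsFrobeniusFree (p ^ n) (algebraMap L (L ⊗[K] R) t) := by
  classical
  intro y hy
  set B := Algebra.TensorProduct.basis L b
  have hq : p ^ n ≠ 0 := pow_ne_zero _ (expChar_pos (L ⊗[K] R) p).ne'
  let s : Finset ι := Finset.univ.biUnion fun j => (B.repr (y j)).support
  have h1 : ∑ i ∈ s, (∑ j : Fin (p ^ n), t ^ (j : ℕ) * B.repr (y j) i ^ p ^ n) •
      ((1 : L) ⊗ₜ[K] (b i ^ p ^ n)) = 0 := by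
    rw [← hy]
    simp only [Finset.sum_smul]
    rw [Finset.sum_comm]
    refine Finset.sum_congr rfl fun j _ => ?_
    rw [tmul_pow_eq_linearCombination p n b, Finsupp.sum_of_support_subset _ (s := s)
      (fun i hi => Finset.mem_biUnion.2 ⟨j, Finset.mem_univ _, hi⟩) _
      (fun i _ => by rw [zero_pow hq, zero_smul])]
    rw [← map_pow, Finset.mul_sum]
    simp only [Algebra.smul_def (A := L ⊗[K] R), map_mul, mul_assoc, B]
  have hw := linearIndependent_iff'.1 (linearIndependent_one_tmul (L := L) hb) _ _ h1
  intro j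
  refine B.repr.map_eq_zero_iff.1 (Finsupp.ext fun i => ?_)
  by_contra hi
  exact hi (ht _ (hw i (Finset.mem_biUnion.2
    ⟨j, Finset.mem_univ _, Finsupp.mem_support_iff.2 hi⟩)) j)

end FrobeniusIndependence

section GeometricallyReduced

variable {F K L : Type*} [Field F] [Field K] [Field L] [Algebra F K] [Algebra F L] [Algebra K L]
  [IsScalarTower F K L]

/-- Let `t ∈ F ⊆ K ⊆ L` be such that `F` and `K` are spanned by the powers of `t` over their
`q`-th powers and `1, …, t ^ (q - 1)` are free over `L ^ q`. Then the subalgebras of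
`L ⊗[K] L` are geometrically reduced over `F`. -/
theorem isReduced_tensorProduct_subalgebra (p n : ℕ) [ExpChar F p] (hq : 1 < p ^ n) {t : F}
    (hF : IsFrobeniusSpanning (p ^ n) t) (hK : IsFrobeniusSpanning (p ^ n) (algebraMap F K t))
    (hL : IsFrobeniusFree (p ^ n) (algebraMap F L t)) (D : Subalgebra F (L ⊗[K] L))
    (Ω : Type*) [Field Ω] [Algebra F Ω] : IsReduced (Ω ⊗[F] D) := by
  have : ExpChar L p := expChar_of_injective_algebraMap (algebraMap F L).injective p
  have : ExpChar (L ⊗[K] L) p :=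
    expChar_of_injective_algebraMap (algebraMap L (L ⊗[K] L)).injective p
  have : ExpChar D p := expChar_of_injective_algebraMap (algebraMap F D).injective p
  have : ExpChar (Ω ⊗[F] D) p :=
    have := expChar_of_injective_algebraMap (algebraMap F Ω).injective p
    expChar_of_injective_algebraMap (algebraMap Ω (Ω ⊗[F] D)).injective p
  have hL' : IsFrobeniusFree (p ^ n) (algebraMap K L (algebraMap F K t)) := by
    rwa [← IsScalarTower.algebraMap_apply]
  have hB : IsFrobeniusFree (p ^ n) (algebraMap L (L ⊗[K] L) (algebraMap F L t)) :=
    hL.tensorProduct p n (Module.Basis.ofVectorSpace K L)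
      (linearIndependent_pow_of_isFrobeniusFree p n hK hL'
        (Module.Basis.ofVectorSpace K L).linearIndependent)
  rw [← IsScalarTower.algebraMap_apply] at hB
  have hD : IsFrobeniusFree (p ^ n) (algebraMap F D t) := by
    intro y hy j
    have := hB (fun j => (y j : L ⊗[K] L)) (by simpa using congrArg D.val hy) j
    exact Subtype.ext this
  exact isReduced_tensorProduct p n hq (Module.Basis.ofVectorSpace F D)
    (linearIndependent_pow_of_isFrobeniusFree p n hF hD
      (Module.Basis.ofVectorSpace F D).linearIndependent)

end GeometricallyReduced

/-! ### The difference Galois group and the constants -/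

section FixedGaloisRing

theorem exists_ringHom_tensorProduct {K L M B : Type*} [CommRing K] [CommRing L] [CommRing M]
    [CommRing B] [Algebra K L] [Algebra K M] (f : L →+* B) (g : M →+* B)
    (h : ∀ k : K, f (algebraMap K L k) = g (algebraMap K M k)) :
    ∃ S : L ⊗[K] M →+* B, ∀ a b, S (a ⊗ₜ b) = f a * g b := by
  let : Algebra K B := (f.comp (algebraMap K L)).toAlgebra
  let f' : L →ₐ[K] B := { f with commutes' := fun _ => rfl }
  let g' : M →ₐ[K] B := { g with commutes' := fun k => (h k).symm }
  exact ⟨(Algebra.TensorProduct.productMap f' g' : L ⊗[K] M →ₐ[K] B), fun a b =>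
    Algebra.TensorProduct.productMap_apply_tmul f' g' a b⟩

variable {F K L : Type*} [Field F] [Field K] [Field L] [Algebra F K] [Algebra F L] [Algebra K L]
  [IsScalarTower F K L] {r : ℕ}

/-- If `F` is the field of constants of `σ` and `σ(Ψ) = Φ Ψ` with `Φ` defined over `K`, then
`Ψ̃` is invariant under `σ ⊗ σ`, and `L` and `Δ` are linearly disjoint over `F`. -/
theorem galoisRing.lift_val_injective (σ : L →+* L)
    (hσK : ∀ k : K, σ (algebraMap K L k) ∈ (algebraMap K L).range)
    (hσF : ∀ a : F, σ (algebraMap F L a) = algebraMap F L a)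
    (hσ : ∀ a : L, σ a = a → a ∈ (algebraMap F L).range)
    (Φ : GL (Fin r) K) (Ψ : GL (Fin r) L)
    (hΨ : Matrix.GeneralLinearGroup.map σ Ψ =
      Matrix.GeneralLinearGroup.map (algebraMap K L) Φ * Ψ) :
    Function.Injective
      (Algebra.TensorProduct.lift (Algebra.ofId L (L ⊗[K] L)) (galoisRing F K Ψ).val
        fun _ _ => .all _ _ : L ⊗[F] galoisRing F K Ψ →ₐ[L] L ⊗[K] L) := by
  let i₁ : L →+* L ⊗[K] L := Algebra.TensorProduct.includeLeftRingHom
  let i₂ : L →+* L ⊗[K] L := ((Algebra.TensorProduct.includeRight : L →ₐ[K] L ⊗[K] L) : _ →+* _)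
  have hi : ∀ k : K, i₁ (algebraMap K L k) = i₂ (algebraMap K L k) := fun k => by
    change algebraMap K L k ⊗ₜ[K] (1 : L) = (1 : L) ⊗ₜ[K] algebraMap K L k
    rw [Algebra.algebraMap_eq_smul_one, TensorProduct.smul_tmul]
  obtain ⟨S, hS⟩ := exists_ringHom_tensorProduct (K := K) (i₁.comp σ) (i₂.comp σ) fun k => by
    obtain ⟨k', hk'⟩ := hσK k
    rw [RingHom.comp_apply, RingHom.comp_apply, ← hk', hi]
  have hS' : ∀ a b : L, S (a ⊗ₜ b) = σ a ⊗ₜ σ b := fun a b => by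
    rw [hS]
    simp [i₁, i₂]
  refine lift_val_injective_of_fixed σ hσ S hS' _ ?_
  let S' : L ⊗[K] L →ₐ[F] L ⊗[K] L := { S with
    commutes' := fun a => by
      change S (algebraMap F L a ⊗ₜ 1) = algebraMap F L a ⊗ₜ 1
      rw [hS', hσF, map_one] }
  have hS₁ : Matrix.GeneralLinearGroup.map (S' : L ⊗[K] L →+* L ⊗[K] L)
      (Matrix.GeneralLinearGroup.map i₁ Ψ) = Matrix.GeneralLinearGroup.map i₁
        (Matrix.GeneralLinearGroup.map (algebraMap K L) Φ) *
          Matrix.GeneralLinearGroup.map i₁ Ψ := by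
    rw [← map_mul, ← hΨ]
    ext i j
    exact (hS' _ _).trans (by rw [map_one]; rfl)
  have hS₂ : Matrix.GeneralLinearGroup.map (S' : L ⊗[K] L →+* L ⊗[K] L)
      (Matrix.GeneralLinearGroup.map i₂ Ψ) = Matrix.GeneralLinearGroup.map i₁
        (Matrix.GeneralLinearGroup.map (algebraMap K L) Φ) *
          Matrix.GeneralLinearGroup.map i₂ Ψ := by
    have h1 : Matrix.GeneralLinearGroup.map i₁ (Matrix.GeneralLinearGroup.map (algebraMap K L) Φ) =
        Matrix.GeneralLinearGroup.map i₂ (Matrix.GeneralLinearGroup.map (algebraMap K L) Φ) := by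
      ext i j
      exact hi _
    rw [h1, ← map_mul, ← hΨ]
    ext i j
    exact (hS' _ _).trans (by rw [map_one]; rfl)
  rintro _ ⟨P, rfl⟩
  change S' (GLRing.eval F (psiTilde K Ψ) P) = GLRing.eval F (psiTilde K Ψ) P
  rw [GLRing.apply_eval]
  congr 2
  change Matrix.GeneralLinearGroup.map (S' : L ⊗[K] L →+* L ⊗[K] L)
    ((Matrix.GeneralLinearGroup.map i₁ Ψ)⁻¹ * Matrix.GeneralLinearGroup.map i₂ Ψ) =
    (Matrix.GeneralLinearGroup.map i₁ Ψ)⁻¹ * Matrix.GeneralLinearGroup.map i₂ Ψ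
  rw [map_mul, map_inv, hS₁, hS₂, mul_inv_rev, mul_assoc, inv_mul_cancel_left]

end FixedGaloisRing

/-! ### The operator `σ` on `k̄(t)` -/

section TateBasics

variable (Fq : Type*) [Field Fq] [Fintype Fq]

/-- The elements of `Fq` are the roots of `X ^ q - X` in every extension of `Fq`. -/
theorem mem_range_algebraMap_of_pow_card_eq {C : Type*} [Field C] [Algebra Fq C] {a : C}
    (ha : a ^ Fintype.card Fq = a) : a ∈ (algebraMap Fq C).range := by
  classical
  have h1 : (Polynomial.X ^ Fintype.card Fq - Polynomial.X : Polynomial Fq) =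
      (Finset.univ.val.map fun b : Fq => Polynomial.X - Polynomial.C b).prod := by
    rw [← FiniteField.roots_X_pow_card_sub_X]
    refine (Polynomial.prod_multiset_X_sub_C_of_monic_of_roots_card_eq ?_ ?_).symm
    · exact Polynomial.monic_X_pow_sub (by
        rw [Polynomial.degree_X]; exact_mod_cast Fintype.one_lt_card)
    · rw [FiniteField.roots_X_pow_card_sub_X, FiniteField.X_pow_card_sub_X_natDegree_eq _
        Fintype.one_lt_card]
      rfl
  have h2 := congrArg (Polynomial.aeval a) h1
  rw [map_sub, map_pow, Polynomial.aeval_X, ha, sub_self] at h2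
  have h3 : ∏ b : Fq, (a - algebraMap Fq C b) = 0 := by
    rw [h2]
    change _ = Polynomial.aeval a (∏ b : Fq, (Polynomial.X - Polynomial.C b))
    simp [map_prod]
  obtain ⟨b, -, hb⟩ := Finset.prod_eq_zero_iff.1 h3
  exact ⟨b, (sub_eq_zero.1 hb).symm⟩

theorem exists_prime_card_eq_pow : ∃ p n : ℕ, p.Prime ∧ CharP Fq p ∧ Fintype.card Fq = p ^ n := by
  obtain ⟨p, hp⟩ := CharP.exists Fq
  obtain ⟨n, hp', hn⟩ := FiniteField.card Fq p
  exact ⟨p, n, hp', hp, hn⟩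

namespace TateField

theorem algebraMap_injective : Function.Injective (algebraMap (Tate Fq) (TateField Fq)) :=
  IsFractionRing.injective _ _

theorem charP (p : ℕ) [CharP Fq p] : CharP (TateField Fq) p :=
  charP_of_injective_ringHom
    ((const Fq).comp (algebraMap Fq (CInf Fq))).injective p

theorem sigma_algebraMap (f : Tate Fq) : sigma Fq (algebraMap (Tate Fq) (TateField Fq) f) =
    algebraMap (Tate Fq) (TateField Fq) ((Tate.frobTwist Fq).symm f) :=
  IsFractionRing.ringEquivOfRingEquiv_algebraMap _ _

theorem frobTwist_const (a : CInf Fq) :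
    Tate.frobTwist Fq (Tate.const Fq a) = Tate.const Fq (CInf.frob Fq a) :=
  Subtype.ext (PowerSeries.map_C (CInf.frob Fq).toRingHom a)

theorem frobTwist_t : Tate.frobTwist Fq (Tate.t Fq) = Tate.t Fq :=
  Subtype.ext (PowerSeries.map_X (CInf.frob Fq).toRingHom)

theorem sigma_t : sigma Fq (t Fq) = t Fq := by
  rw [t, sigma_algebraMap, RingEquiv.symm_apply_eq _ |>.2 (frobTwist_t Fq).symm]

theorem sigma_const (a : CInf Fq) : sigma Fq (const Fq a) = const Fq ((CInf.frob Fq).symm a) := by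
  rw [const, RingHom.comp_apply, sigma_algebraMap, RingHom.comp_apply]
  congr 1
  rw [RingEquiv.symm_apply_eq, frobTwist_const, RingEquiv.apply_symm_apply]

theorem sigma_const_algebraMap (a : Fq) : sigma Fq (const Fq (algebraMap Fq (CInf Fq) a)) =
    const Fq (algebraMap Fq (CInf Fq) a) := by
  rw [sigma_const]
  congr 1
  rw [RingEquiv.symm_apply_eq, CInf.frob_apply, ← map_pow, FiniteField.pow_card]

/-- The elements of `k̄` have `q`-th roots in `k̄`. -/
theorem frob_symm_mem (a : KBar Fq) : (CInf.frob Fq).symm (a : CInf Fq) ∈ KBar Fq := by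
  rw [mem_algebraicClosure_iff]
  have h : IsAlgebraic (RatFunc Fq) (((CInf.frob Fq).symm (a : CInf Fq)) ^ Fintype.card Fq) := by
    rw [← CInf.frob_apply, RingEquiv.apply_symm_apply]
    exact mem_algebraicClosure_iff.1 a.2
  exact h.of_pow Fintype.card_pos

theorem const_mem_ratKBar {a : CInf Fq} (ha : a ∈ KBar Fq) : const Fq a ∈ ratKBar Fq :=
  Subfield.subset_closure (Or.inr ⟨⟨a, ha⟩, rfl⟩)

theorem t_mem_ratKBar : t Fq ∈ ratKBar Fq := Subfield.subset_closure (Or.inl rfl)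

theorem t_mem_ratF : t Fq ∈ ratF Fq := Subfield.subset_closure (Or.inl rfl)

theorem const_mem_ratF (a : Fq) : const Fq (algebraMap Fq (CInf Fq) a) ∈ ratF Fq :=
  Subfield.subset_closure (Or.inr ⟨a, rfl⟩)

theorem algebraMap_mem_KBar (a : Fq) : algebraMap Fq (CInf Fq) a ∈ KBar Fq := by
  refine mem_algebraicClosure_iff.2
    ⟨Polynomial.X ^ Fintype.card Fq - Polynomial.X, FiniteField.X_pow_card_sub_X_ne_zero _
      Fintype.one_lt_card, ?_⟩
  rw [map_sub, map_pow, Polynomial.aeval_X, ← map_pow, FiniteField.pow_card, sub_self]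

theorem ratF_le_ratKBar : ratF Fq ≤ ratKBar Fq := by
  refine Subfield.closure_le.2 (Set.insert_subset (t_mem_ratKBar Fq) ?_)
  rintro _ ⟨a, rfl⟩
  exact const_mem_ratKBar Fq (algebraMap_mem_KBar Fq a)

theorem sigma_mem_ratKBar {x : TateField Fq} (hx : x ∈ ratKBar Fq) : sigma Fq x ∈ ratKBar Fq := by
  have h : ratKBar Fq ≤ (ratKBar Fq).comap (sigma Fq).toRingHom := by
    refine Subfield.closure_le.2 (Set.insert_subset ?_ ?_)
    · change sigma Fq (t Fq) ∈ ratKBar Fq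
      rw [sigma_t]
      exact t_mem_ratKBar Fq
    · rintro _ ⟨a, rfl⟩
      change sigma Fq (const Fq a) ∈ ratKBar Fq
      rw [sigma_const]
      exact const_mem_ratKBar Fq (frob_symm_mem Fq a)
  exact h hx

theorem sigma_eq_of_mem_ratF {x : TateField Fq} (hx : x ∈ ratF Fq) : sigma Fq x = x := by
  have h : ratF Fq ≤ (sigma Fq).toRingHom.eqLocusField (RingHom.id _) := by
    refine Subfield.closure_le.2 (Set.insert_subset (sigma_t Fq) ?_)
    rintro _ ⟨a, rfl⟩
    exact sigma_const_algebraMap Fq a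
  exact h hx

end TateField

end TateBasics

section Spanning

/-- A field generated by `t` and by elements that have `q`-th roots in the field is spanned
by the powers of `t` over its `q`-th powers. -/
theorem isFrobeniusSpanning_closure {L : Type*} [Field L] (p n : ℕ) [ExpChar L p] (t : L)
    (S : Set L)
    (hS : ∀ s ∈ S, ∃ u ∈ Subfield.closure (insert t S), u ^ p ^ n = s) :
    IsFrobeniusSpanning (R := Subfield.closure (insert t S)) (p ^ n)
      ⟨t, Subfield.subset_closure (Set.mem_insert _ _)⟩ := by
  set M := Subfield.closure (insert t S)
  let τ : M := ⟨t, Subfield.subset_closure (Set.mem_insert _ _)⟩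
  have hexp : ExpChar M p := RingHom.expChar M.subtype M.subtype_injective p
  have hq : 0 < p ^ n := pow_pos (expChar_pos L p) n
  let P : M → Prop := fun a =>
    ∃ y : Fin (p ^ n) → M, ∑ j : Fin (p ^ n), τ ^ (j : ℕ) * y j ^ p ^ n = a
  have hadd : ∀ a b, P a → P b → P (a + b) := by
    rintro _ _ ⟨y, rfl⟩ ⟨z, rfl⟩
    refine ⟨y + z, ?_⟩
    simp only [Pi.add_apply, add_pow_expChar_pow, mul_add, Finset.sum_add_distrib]
  have hpow : ∀ a c, P a → P (c ^ p ^ n * a) := by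
    rintro _ c ⟨y, rfl⟩
    refine ⟨fun j => c * y j, ?_⟩
    rw [Finset.mul_sum]
    refine Finset.sum_congr rfl fun j _ => ?_
    rw [mul_pow]
    ring
  have hmon : ∀ j : ℕ, P (τ ^ j) := by
    intro j
    have h1 : P (τ ^ (j % p ^ n)) :=
      ⟨Pi.single ⟨j % p ^ n, Nat.mod_lt _ hq⟩ 1, by
        rw [Finset.sum_eq_single ⟨j % p ^ n, Nat.mod_lt _ hq⟩]
        · simp
        · intro b _ hb
          rw [Pi.single_eq_of_ne hb, zero_pow hq.ne', mul_zero]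
        · simp⟩
    have h2 := hpow _ (τ ^ (j / p ^ n)) h1
    rwa [← pow_mul, ← pow_add, Nat.div_add_mod'] at h2
  have hsum : ∀ (s : Finset (Fin (p ^ n))) (f : Fin (p ^ n) → M), (∀ j ∈ s, P (f j)) →
      P (∑ j ∈ s, f j) := by
    intro s f hf
    have hzero : P 0 := by
      have := hpow _ 0 (hmon 0)
      rwa [zero_pow hq.ne', zero_mul] at this
    exact Finset.sum_induction f P hadd hzero hf
  have hmul : ∀ a b, P a → P b → P (a * b) := by
    rintro _ b ⟨y, rfl⟩ ⟨z, rfl⟩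
    rw [Finset.sum_mul_sum]
    refine hsum _ _ fun i _ => hsum _ _ fun j _ => ?_
    have := hpow _ (y i * z j) (hmon (i + j))
    rwa [show (y i * z j) ^ p ^ n * τ ^ ((i : ℕ) + j) =
      τ ^ (i : ℕ) * y i ^ p ^ n * (τ ^ (j : ℕ) * z j ^ p ^ n) by
        rw [mul_pow, pow_add]; ring] at this
  have hone : ∀ c, P (c ^ p ^ n) := fun c => by simpa using hpow _ c (hmon 0)
  suffices h : ∀ x (hx : x ∈ M), P ⟨x, hx⟩ from fun a => h a.1 a.2
  intro x hx
  induction hx using Subfield.closure_induction with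
  | mem x hx =>
    rcases hx with rfl | hx
    · simpa using hmon 1
    · obtain ⟨u, hu, rfl⟩ := hS x hx
      exact hone ⟨u, hu⟩
  | one =>
    have := hone 1
    rw [one_pow] at this
    exact this
  | add x y hx hy h1 h2 => exact hadd _ _ h1 h2
  | neg x hx h1 =>
    have := hpow _ (-1) h1
    rw [neg_one_pow_expChar_pow, neg_one_mul] at this
    exact this
  | inv x hx h1 =>
    by_cases hx0 : (⟨x, hx⟩ : M) = 0
    · have h2 : (⟨x⁻¹, inv_mem hx⟩ : M) = ⟨x, hx⟩ := by
        have : x = 0 := congrArg Subtype.val hx0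
        subst this
        simp
      rwa [h2]
    · have hpw : ∀ k : ℕ, P ((⟨x, hx⟩ : M) ^ k) := by
        intro k
        induction k with
        | zero => simpa using hmon 0
        | succ k ih => rw [pow_succ]; exact hmul _ _ ih h1
      have h2 := hpow _ (⟨x, hx⟩ : M)⁻¹ (hpw (p ^ n - 1))
      have h3 : ((⟨x, hx⟩ : M)⁻¹) ^ p ^ n * (⟨x, hx⟩ : M) ^ (p ^ n - 1) = (⟨x, hx⟩ : M)⁻¹ := by
        obtain ⟨k, hk⟩ : ∃ k, p ^ n = k + 1 := ⟨p ^ n - 1, by omega⟩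
        rw [hk, Nat.add_sub_cancel, pow_succ, inv_pow]
        field_simp
      rw [h3] at h2
      exact h2
  | mul x y hx hy h1 h2 => exact hmul _ _ h1 h2

end Spanning

/-! ### The operator `σ` on `𝕃`, and its constants -/

section TatePower

variable (Fq : Type*) [Field Fq] [Fintype Fq]

namespace TateField

theorem isFrobeniusSpanning_ratF (p n : ℕ) [ExpChar (TateField Fq) p]
    (hq : Fintype.card Fq = p ^ n) :
    IsFrobeniusSpanning (p ^ n) (⟨t Fq, t_mem_ratF Fq⟩ : ratF Fq) := by
  refine isFrobeniusSpanning_closure p n (t Fq) _ ?_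
  rintro _ ⟨a, rfl⟩
  exact ⟨_, const_mem_ratF Fq a, by rw [← map_pow, ← map_pow, ← hq, FiniteField.pow_card]⟩

theorem isFrobeniusSpanning_ratKBar (p n : ℕ) [ExpChar (TateField Fq) p]
    (hq : Fintype.card Fq = p ^ n) :
    IsFrobeniusSpanning (p ^ n) (⟨t Fq, t_mem_ratKBar Fq⟩ : ratKBar Fq) := by
  refine isFrobeniusSpanning_closure p n (t Fq) _ ?_
  rintro _ ⟨a, rfl⟩
  refine ⟨_, const_mem_ratKBar Fq (frob_symm_mem Fq a), ?_⟩
  rw [← map_pow, ← hq, ← CInf.frob_apply, RingEquiv.apply_symm_apply]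

/-- The order of vanishing of `t ^ j * y ^ q` at `t = 0` determines `j < q`, so there is no
cancellation in a sum of such terms. -/
theorem powerSeries_sum_X_pow_mul_pow_eq_zero {C : Type*} [Field C] {q : ℕ}
    (f : Fin q → PowerSeries C)
    (h : ∑ j : Fin q, PowerSeries.X ^ (j : ℕ) * f j ^ q = 0) (j : Fin q) : f j = 0 := by
  classical
  by_contra hj
  let s : Finset (Fin q) := Finset.univ.filter fun i => f i ≠ 0
  have hord : ∀ i, f i ≠ 0 → (f i).order = ((f i).order.toNat : ℕ∞) := fun i hi =>
    (ENat.natCast_toNat (PowerSeries.order_eq_top.not.2 hi)).symm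
  let e : Fin q → ℕ := fun i => i + q * (f i).order.toNat
  have he : ∀ i, f i ≠ 0 → (PowerSeries.X ^ (i : ℕ) * f i ^ q).order = (e i : ℕ∞) := fun i hi => by
    rw [PowerSeries.order_mul, PowerSeries.order_X_pow, PowerSeries.order_pow, hord i hi]
    simp [e]
  obtain ⟨i, hi, hmin⟩ := s.exists_min_image e ⟨j, by simpa [s] using hj⟩
  have hi0 : f i ≠ 0 := by simpa [s] using hi
  have hco := congrArg (PowerSeries.coeff (e i)) h
  rw [map_sum, map_zero, Finset.sum_eq_single i] at hco
  · have hne := PowerSeries.coeff_order (mul_ne_zero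
      (pow_ne_zero (i : ℕ) (PowerSeries.X_ne_zero (R := C))) (pow_ne_zero q hi0))
    rw [he i hi0, ENat.toNat_natCast] at hne
    exact hne hco
  · intro k _ hki
    by_cases hk : f k = 0
    · rw [hk, zero_pow (Fin.pos j).ne', mul_zero, map_zero]
    refine PowerSeries.coeff_of_lt_order _ ?_
    rw [he k hk]
    refine Nat.cast_lt.2 (lt_of_le_of_ne (hmin k (by simpa [s] using hk)) fun hik => hki ?_)
    have := congrArg (· % q) hik
    simp only [e, Nat.add_mul_mod_self_left, Nat.mod_eq_of_lt (Fin.isLt _)] at this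
    exact (Fin.ext this).symm
  · simp

theorem isFrobeniusFree (p n : ℕ) [ExpChar (TateField Fq) p] :
    IsFrobeniusFree (p ^ n) (t Fq) := by
  intro y hy j
  have hq : p ^ n ≠ 0 := (pow_pos (expChar_pos (TateField Fq) p) n).ne'
  obtain ⟨⟨b, hb⟩, hint⟩ := IsLocalization.exist_integer_multiples (nonZeroDivisors (Tate Fq))
    Finset.univ y
  choose f hf using fun j => hint j (Finset.mem_univ j)
  simp only [Algebra.smul_def] at hf
  have h1 : ∑ j : Fin (p ^ n), Tate.t Fq ^ (j : ℕ) * f j ^ p ^ n = 0 := by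
    apply algebraMap_injective Fq
    rw [map_zero, ← mul_zero (algebraMap (Tate Fq) (TateField Fq) b ^ p ^ n), ← hy, map_sum,
      Finset.mul_sum]
    refine Finset.sum_congr rfl fun j _ => ?_
    rw [map_mul, map_pow, map_pow, hf, mul_pow]
    change t Fq ^ (j : ℕ) * _ = _
    ring
  have h2 := powerSeries_sum_X_pow_mul_pow_eq_zero (fun j => (f j).1)
    (by simpa using! congrArg (Subring.subtype _) h1) j
  have h3 : f j = 0 := Subtype.ext h2
  have h4 := hf j
  rw [h3, map_zero] at h4
  exact (mul_eq_zero.1 h4.symm).resolve_left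
    ((map_ne_zero_iff _ (algebraMap_injective Fq)).2 (nonZeroDivisors.ne_zero hb))

/-- The polynomials, as elements of `𝕋`. -/
noncomputable def ofPoly : Polynomial (CInf Fq) →+* Tate Fq :=
  Polynomial.eval₂RingHom (Tate.const Fq) (Tate.t Fq)

theorem coe_ofPoly (P : Polynomial (CInf Fq)) : (ofPoly Fq P).1 = (P : PowerSeries (CInf Fq)) := by
  have h : (Subring.subtype _).comp (ofPoly Fq) = Polynomial.coeToPowerSeries.ringHom := by
    ext1
    · ext1 a
      simp [ofPoly, Tate.const]
      rfl
    · simp [ofPoly, Tate.t]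
  exact DFunLike.congr_fun h P

theorem algebraMap_ofPoly_map_mem_ratF (P : Polynomial Fq) :
    algebraMap (Tate Fq) (TateField Fq) (ofPoly Fq (P.map (algebraMap Fq (CInf Fq)))) ∈
      ratF Fq := by
  rw [ofPoly, Polynomial.coe_eval₂RingHom, Polynomial.eval₂_map, Polynomial.eval₂_eq_sum_range,
    map_sum]
  refine sum_mem fun i _ => ?_
  rw [map_mul, map_pow]
  exact mul_mem (const_mem_ratF Fq _) (pow_mem (t_mem_ratF Fq) _)

theorem norm_algebraMap_le_one (c : Fq) : ‖algebraMap Fq (CInf Fq) c‖ ≤ 1 := by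
  have h : ‖algebraMap Fq (CInf Fq) c‖ ^ Fintype.card Fq = ‖algebraMap Fq (CInf Fq) c‖ := by
    rw [← norm_pow, ← map_pow, FiniteField.pow_card]
  by_contra! h1
  exact (lt_self_pow₀ h1 Fintype.one_lt_card).ne' h

/-- A restricted power series `g ≠ 0` can be turned into a nonzero polynomial over `Fq` by an
`Fq`-linear functional on the coefficients: choose one that kills all elements smaller than a
given nonzero coefficient of `g`, but not this coefficient. The functional also turns every
other restricted power series into a polynomial. -/
theorem exists_linearMap_coeff_ne_zero {g : Tate Fq} (hg : g ≠ 0) :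
    ∃ l : CInf Fq →ₗ[Fq] Fq, (∃ m, l (PowerSeries.coeff m g.1) ≠ 0) ∧
      ∀ f : Tate Fq, ∃ N, ∀ n, N ≤ n → l (PowerSeries.coeff n f.1) = 0 := by
  obtain ⟨m, hm⟩ : ∃ m, PowerSeries.coeff m g.1 ≠ 0 := by
    by_contra! h
    exact hg (Subtype.ext (PowerSeries.ext fun n => by simpa using h n))
  let B : Submodule Fq (CInf Fq) :=
    { carrier := {a | ‖a‖ < ‖PowerSeries.coeff m g.1‖}
      add_mem' := fun {a b} ha hb =>
        (IsUltrametricDist.norm_add_le_max a b).trans_lt (max_lt ha hb)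
      zero_mem' := by simpa using hm
      smul_mem' := fun c a ha => by
        change ‖c • a‖ < _
        rw [Algebra.smul_def, norm_mul]
        exact (mul_le_of_le_one_left (norm_nonneg _) (norm_algebraMap_le_one Fq c)).trans_lt ha }
  obtain ⟨l, hl, hB⟩ := B.exists_dual_map_eq_bot_of_notMem
    (x := PowerSeries.coeff m g.1) (lt_irrefl ‖PowerSeries.coeff m g.1‖) inferInstance
  refine ⟨l, ⟨m, hl⟩, fun f => ?_⟩
  have h := (Tate.mem_iff Fq f.1).1 f.2
  obtain ⟨N, hN⟩ := Filter.eventually_atTop.1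
    (h.eventually (gt_mem_nhds (norm_pos_iff.2 hm)))
  refine ⟨N, fun n hn => ?_⟩
  have h1 : l (PowerSeries.coeff n f.1) ∈ B.map l := ⟨_, hN n hn, rfl⟩
  rw [hB] at h1
  exact h1

/-- The field of constants of `σ` on `𝕃` is `Fq(t)`. -/
theorem mem_ratF_of_sigma_eq {y : TateField Fq} (hy : sigma Fq y = y) : y ∈ ratF Fq := by
  obtain ⟨f, g, hg, rfl⟩ := IsFractionRing.div_surjective (A := Tate Fq) y
  have hg0 : g ≠ 0 := nonZeroDivisors.ne_zero hg
  have hg1 : g.1 ≠ 0 := fun h => hg0 (Subtype.ext h)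
  have hgL : algebraMap (Tate Fq) (TateField Fq) g ≠ 0 :=
    (map_ne_zero_iff _ (algebraMap_injective Fq)).2 hg0
  let φ := PowerSeries.map (CInf.frob Fq).toRingHom
  have hφ : φ g.1 ≠ 0 :=
    (map_ne_zero_iff φ (PowerSeries.map_injective _ (CInf.frob Fq).injective)).2 hg1
  -- `f / g` is a Laurent series fixed by the Frobenius of the coefficients
  have hcross : φ f.1 * g.1 = f.1 * φ g.1 := by
    have h1 : algebraMap (Tate Fq) (TateField Fq) ((Tate.frobTwist Fq).symm f * g) =
        algebraMap (Tate Fq) (TateField Fq) (f * (Tate.frobTwist Fq).symm g) := by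
      rw [map_div₀, sigma_algebraMap, sigma_algebraMap, div_eq_div_iff
        ((map_ne_zero_iff _ (algebraMap_injective Fq)).2 (by simpa using hg0)) hgL] at hy
      rw [map_mul, map_mul, hy]
    have h2 := congrArg (Tate.frobTwist Fq) (algebraMap_injective Fq h1)
    rw [map_mul, map_mul, RingEquiv.apply_symm_apply, RingEquiv.apply_symm_apply] at h2
    exact (congrArg Subtype.val h2).symm
  obtain ⟨n, Y, hY⟩ : ∃ (n : ℕ) (Y : PowerSeries (CInf Fq)),
      Y * g.1 = PowerSeries.X ^ n * f.1 := by
    refine ⟨g.1.order.toNat, f.1 * (g.1.divXPowOrder)⁻¹, ?_⟩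
    have h1 := PowerSeries.inv_mul_cancel g.1.divXPowOrder
      (by rwa [Ne, PowerSeries.constantCoeff_divXPowOrder_eq_zero_iff])
    calc f.1 * (g.1.divXPowOrder)⁻¹ * g.1
        = f.1 * (g.1.divXPowOrder)⁻¹ * (PowerSeries.X ^ g.1.order.toNat * g.1.divXPowOrder) := by
          rw [PowerSeries.X_pow_order_mul_divXPowOrder]
      _ = PowerSeries.X ^ g.1.order.toNat * f.1 * ((g.1.divXPowOrder)⁻¹ * g.1.divXPowOrder) := by
          ring
      _ = _ := by rw [h1, mul_one]
  have hYφ : φ Y = Y := by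
    have h1 := congrArg φ hY
    rw [map_mul, map_mul, map_pow, PowerSeries.map_X] at h1
    refine mul_right_cancel₀ (mul_ne_zero hφ hg1) ?_
    calc φ Y * (φ g.1 * g.1) = (φ Y * φ g.1) * g.1 := by ring
      _ = PowerSeries.X ^ n * (φ f.1 * g.1) := by rw [h1]; ring
      _ = (PowerSeries.X ^ n * f.1) * φ g.1 := by rw [hcross]; ring
      _ = Y * (φ g.1 * g.1) := by rw [← hY]; ring
  have hYFq : ∀ i, ∃ a : Fq, algebraMap Fq (CInf Fq) a = PowerSeries.coeff i Y := fun i =>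
    mem_range_algebraMap_of_pow_card_eq Fq (by
      have := congrArg (PowerSeries.coeff i) hYφ
      rw [PowerSeries.coeff_map] at this
      exact this)
  choose u hu using hYFq
  obtain ⟨l, ⟨m, hm⟩, hl⟩ := exists_linearMap_coeff_ne_zero Fq hg0
  -- the functional turns `g` and `X ^ n f` into polynomials `P` and `Q` over `Fq` with `Y P = Q`
  have hpoly : ∀ f : Tate Fq, ∃ P : Polynomial Fq,
      ∀ i, P.coeff i = l (PowerSeries.coeff i f.1) := by
    intro f
    obtain ⟨N, hN⟩ := hl f
    refine ⟨PowerSeries.trunc N (PowerSeries.mk fun i => l (PowerSeries.coeff i f.1)), fun i => ?_⟩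
    rw [PowerSeries.coeff_trunc, PowerSeries.coeff_mk]
    split_ifs with h
    · rfl
    · exact (hN i (not_lt.1 h)).symm
  obtain ⟨P, hP⟩ := hpoly g
  obtain ⟨Q, hQ⟩ := hpoly (Tate.t Fq ^ n * f)
  have hP0 : P ≠ 0 := fun h => hm (by rw [← hP, h, Polynomial.coeff_zero])
  have hYP : Y * (P.map (algebraMap Fq (CInf Fq)) : PowerSeries (CInf Fq)) =
      (Q.map (algebraMap Fq (CInf Fq)) : PowerSeries (CInf Fq)) := by
    ext i
    rw [Polynomial.coeff_coe, Polynomial.coeff_map, hQ]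
    change _ = algebraMap Fq (CInf Fq) (l (PowerSeries.coeff i (PowerSeries.X ^ n * f.1)))
    rw [← hY, PowerSeries.coeff_mul, PowerSeries.coeff_mul, map_sum, map_sum]
    refine Finset.sum_congr rfl fun ij _ => ?_
    rw [Polynomial.coeff_coe, Polynomial.coeff_map, hP, ← hu, ← map_mul, ← Algebra.smul_def,
      map_smul, smul_eq_mul]
  have hmain : Tate.t Fq ^ n * f * ofPoly Fq (P.map (algebraMap Fq (CInf Fq))) =
      ofPoly Fq (Q.map (algebraMap Fq (CInf Fq))) * g := by
    apply Subtype.ext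
    change PowerSeries.X ^ n * f.1 * (ofPoly Fq _).1 = (ofPoly Fq _).1 * g.1
    rw [coe_ofPoly, coe_ofPoly, ← hYP, ← hY]
    ring
  have hPL : algebraMap (Tate Fq) (TateField Fq)
      (ofPoly Fq (P.map (algebraMap Fq (CInf Fq)))) ≠ 0 := by
    rw [map_ne_zero_iff _ (algebraMap_injective Fq)]
    intro h
    have h1 := congrArg Subtype.val h
    rw [coe_ofPoly] at h1
    exact hP0 ((Polynomial.map_eq_zero _).1 (Polynomial.coe_eq_zero_iff.1 h1))
  have htL : t Fq ≠ 0 := by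
    rw [t, map_ne_zero_iff _ (algebraMap_injective Fq)]
    exact fun h => PowerSeries.X_ne_zero (congrArg Subtype.val h)
  have hfinal : algebraMap (Tate Fq) (TateField Fq) f / algebraMap (Tate Fq) (TateField Fq) g =
      algebraMap (Tate Fq) (TateField Fq) (ofPoly Fq (Q.map (algebraMap Fq (CInf Fq)))) /
      (t Fq ^ n *
        algebraMap (Tate Fq) (TateField Fq) (ofPoly Fq (P.map (algebraMap Fq (CInf Fq))))) := by
    rw [div_eq_div_iff hgL (mul_ne_zero (pow_ne_zero _ htL) hPL), ← map_mul, ← hmain]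
    simp only [map_mul, map_pow, t]
    ring
  rw [hfinal]
  exact div_mem (algebraMap_ofPoly_map_mem_ratF Fq Q)
    (mul_mem (pow_mem (t_mem_ratF Fq) n) (algebraMap_ofPoly_map_mem_ratF Fq P))

end TateField

end TatePower

/-! ### Smoothness of the difference Galois group -/

section SmoothTate

theorem isScalarTower_inclusion {L : Type*} [Field L] {F K : Subfield L} (h : F ≤ K) :
    @IsScalarTower F K L (Subfield.inclusion h).toAlgebra.toSMul _ _ :=
  let : Algebra F K := (Subfield.inclusion h).toAlgebra
  IsScalarTower.of_algebraMap_eq fun _ => rfl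

variable (Fq : Type*) [Field Fq] [Fintype Fq]

/-- The difference Galois group is geometrically reduced and smooth. -/
theorem smooth_and_isReduced_galoisRing (r : ℕ)
    (Φ : GL (Fin r) (TateField.ratKBar Fq)) (Ψ : GL (Fin r) (TateField Fq))
    (hΨ : Matrix.GeneralLinearGroup.map (TateField.sigma Fq).toRingHom Ψ =
      Matrix.GeneralLinearGroup.map (algebraMap (TateField.ratKBar Fq) (TateField Fq)) Φ * Ψ) :
    Algebra.Smooth (AlgebraicClosure (TateField.ratF Fq))
        (AlgebraicClosure (TateField.ratF Fq) ⊗[TateField.ratF Fq]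
          galoisRing (TateField.ratF Fq) (TateField.ratKBar Fq) Ψ) ∧
      IsReduced (AlgebraicClosure (TateField.ratF Fq) ⊗[TateField.ratF Fq]
          galoisRing (TateField.ratF Fq) (TateField.ratKBar Fq) Ψ) := by
  let : Algebra (TateField.ratF Fq) (TateField.ratKBar Fq) :=
    (Subfield.inclusion (TateField.ratF_le_ratKBar Fq)).toAlgebra
  have : IsScalarTower (TateField.ratF Fq) (TateField.ratKBar Fq) (TateField Fq) :=
    isScalarTower_inclusion (TateField.ratF_le_ratKBar Fq)
  obtain ⟨p, n, hp, hchar, hq⟩ := exists_prime_card_eq_pow Fq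
  have := TateField.charP Fq p
  have : ExpChar (TateField Fq) p := .prime hp
  have : ExpChar (TateField.ratF Fq) p :=
    RingHom.expChar (TateField.ratF Fq).subtype (TateField.ratF Fq).subtype_injective p
  have hred := isReduced_tensorProduct_subalgebra p n (hq ▸ Fintype.one_lt_card)
    (TateField.isFrobeniusSpanning_ratF Fq p n hq)
    (K := TateField.ratKBar Fq) (TateField.isFrobeniusSpanning_ratKBar Fq p n hq)
    (L := TateField Fq) (TateField.isFrobeniusFree Fq p n)
    (galoisRing (TateField.ratF Fq) (TateField.ratKBar Fq) Ψ)
    (AlgebraicClosure (TateField.ratF Fq))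
  refine ⟨?_, hred⟩
  refine galoisRing.smooth_of_isReduced Ψ (galoisRing.lift_val_injective
    (TateField.sigma Fq).toRingHom ?_ ?_ ?_ Φ Ψ hΨ) _
  · intro k
    exact ⟨⟨_, TateField.sigma_mem_ratKBar Fq k.2⟩, rfl⟩
  · intro a
    exact TateField.sigma_eq_of_mem_ratF Fq a.2
  · intro a ha
    exact ⟨⟨a, TateField.mem_ratF_of_sigma_eq Fq ha⟩, rfl⟩

end SmoothTate

/-! ### Algebraic elements of finitely generated field extensions -/

section AlgebraicClosureFinite

open IntermediateField.algebraAdjoinAdjoin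

/-- In a finitely generated field extension, the algebraic closure of the base field is a finite
extension of it: if `s` is a transcendence basis of `Λ` over `K`, then elements that are algebraic
and linearly independent over `K` remain so over `K(s)`. -/
theorem finiteDimensional_algebraicClosure (K Λ : Type*) [Field K] [Field Λ] [Algebra K Λ]
    [Algebra.EssFiniteType K Λ] : FiniteDimensional K (algebraicClosure K Λ) := by
  classical
  obtain ⟨s, hs⟩ := exists_isTranscendenceBasis K Λ
  let E := algebraicClosure K Λ
  have halg : Algebra.IsAlgebraic (IntermediateField.adjoin K s) Λ := by
    have := hs.isAlgebraic_field
    rwa [Subtype.range_coe] at this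
  have : Algebra.EssFiniteType (IntermediateField.adjoin K s) Λ :=
    .of_comp K (IntermediateField.adjoin K s) Λ
  have : FiniteDimensional (IntermediateField.adjoin K s) Λ :=
    Algebra.finite_of_essFiniteType_of_isAlgebraic
  have hsE : AlgebraicIndependent E ((↑) : s → Λ) := hs.1.extendScalars E
  let b := Module.Basis.ofVectorSpace K E
  have hlin : LinearIndependent (Algebra.adjoin K s) (fun i => (b i : Λ)) := by
    rw [linearIndependent_iff']
    intro S g hg i hi
    have hP : ∀ i, ∃ P : MvPolynomial s K, MvPolynomial.aeval ((↑) : s → Λ) P = (g i : Λ) := by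
      intro i
      have h1 : Algebra.adjoin K s = (MvPolynomial.aeval ((↑) : s → Λ)).range := by
        rw [← Algebra.adjoin_range_eq_range_aeval, Subtype.range_coe]
      have h2 : (g i : Λ) ∈ (MvPolynomial.aeval (R := K) ((↑) : s → Λ)).range := h1 ▸ (g i).2
      exact h2
    choose P hP using hP
    let Q : MvPolynomial s E := ∑ i ∈ S, MvPolynomial.C (b i) * (P i).map (algebraMap K E)
    have hQ : MvPolynomial.aeval ((↑) : s → Λ) Q = 0 := by
      rw [← hg]
      simp only [Q, map_sum, map_mul, MvPolynomial.aeval_C]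
      refine Finset.sum_congr rfl fun i _ => ?_
      rw [MvPolynomial.aeval_map_algebraMap, hP, Algebra.smul_def, mul_comm]
      rfl
    have hQ0 : Q = 0 := (injective_iff_map_eq_zero _).1 hsE _ hQ
    have hcoeff : ∀ m, (P i).coeff m = 0 := by
      intro m
      have h1 := congrArg (MvPolynomial.coeff m) hQ0
      simp only [Q, MvPolynomial.coeff_sum, MvPolynomial.coeff_C_mul, MvPolynomial.coeff_map,
        MvPolynomial.coeff_zero] at h1
      refine linearIndependent_iff'.1 b.linearIndependent S (fun i => (P i).coeff m) ?_ i hi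
      rw [← h1]
      refine Finset.sum_congr rfl fun i _ => ?_
      rw [Algebra.smul_def, mul_comm]
    have hPi : P i = 0 := MvPolynomial.ext _ _ fun m => by simpa using hcoeff m
    have h2 := hP i
    rw [hPi, map_zero] at h2
    exact Subtype.ext h2.symm
  have hlin' : LinearIndependent (IntermediateField.adjoin K s) (fun i => (b i : Λ)) :=
    (LinearIndependent.iff_fractionRing (Algebra.adjoin K s)
      (IntermediateField.adjoin K s)).1 hlin
  have : Finite _ := hlin'.finite
  exact Module.Finite.of_basis b

end AlgebraicClosureFinite

/-! ### Taylor coefficients, and fixed vectors of semilinear maps -/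

section PowerSeriesCoeff

open Polynomial in
/-- Specialize a nontrivial relation for `Y` over `κ[X]` that is not divisible by `X`
at `X = 0`. -/
theorem isAlgebraic_constantCoeff {κ C : Type*} [Field κ] [Field C] [Algebra κ C]
    {Y : PowerSeries C} (hY : IsAlgebraic κ[X] Y) :
    IsAlgebraic κ (PowerSeries.constantCoeff Y) := by
  obtain ⟨Q, hQ0, hQ⟩ := hY
  have hXC : (algebraMap κ[X] (PowerSeries C)) X = PowerSeries.X := by
    simp [PowerSeries.algebraMap_apply']
  have hfin : FiniteMultiplicity (Polynomial.C X : κ[X][X]) Q :=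
    FiniteMultiplicity.of_not_isUnit (by
      rw [isUnit_C]; exact not_isUnit_X) hQ0
  obtain ⟨Q', hQ', hndvd⟩ := hfin.exists_eq_pow_mul_and_not_dvd
  have hQY : aeval Y Q' = 0 := by
    rw [hQ', map_mul, map_pow, aeval_C, hXC] at hQ
    exact (mul_eq_zero.1 hQ).resolve_left (pow_ne_zero _ PowerSeries.X_ne_zero)
  refine ⟨Q'.map (evalRingHom 0), fun h => hndvd ?_, ?_⟩
  · rw [C_dvd_iff_dvd_coeff]
    intro i
    rw [X_dvd_iff, coeff_zero_eq_eval_zero]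
    simpa using congrArg (coeff · i) h
  · have h1 := congrArg (PowerSeries.constantCoeff (R := C)) hQY
    rw [map_zero, aeval_def, hom_eval₂] at h1
    rw [aeval_def, eval₂_map, ← h1]
    congr 1
    ext x <;> simp [PowerSeries.algebraMap_apply']

open Polynomial in
/-- The coefficients of a power series that is algebraic over `κ(X)` are algebraic over `κ`. -/
theorem isAlgebraic_coeff {κ C : Type*} [Field κ] [Field C] [Algebra κ C]
    {Y : PowerSeries C} (hY : IsAlgebraic κ[X] Y) (n : ℕ) :
    IsAlgebraic κ (PowerSeries.coeff n Y) := by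
  induction n generalizing Y with
  | zero => simpa using isAlgebraic_constantCoeff hY
  | succ n ih =>
    have h0 : IsAlgebraic κ[X] (PowerSeries.C (PowerSeries.constantCoeff Y)) := by
      have h1 : IsAlgebraic κ (PowerSeries.C (PowerSeries.constantCoeff Y)) :=
        (isAlgebraic_constantCoeff hY).algebraMap
      exact h1.extendScalars (C_injective)
    have hX : IsAlgebraic κ[X] (PowerSeries.X : PowerSeries C) := by
      have := isAlgebraic_algebraMap (A := PowerSeries C) (X : κ[X])
      simpa [PowerSeries.algebraMap_apply'] using this
    have hd : Y - PowerSeries.C (PowerSeries.constantCoeff Y) =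
        PowerSeries.X * PowerSeries.mk fun p => PowerSeries.coeff (p + 1) Y := by
      rw [PowerSeries.sub_const_eq_X_mul_shift]
    have h2 := ih (Y := PowerSeries.mk fun p => PowerSeries.coeff (p + 1) Y) (by
      have h3 := h0.neg.add hY
      rw [neg_add_eq_sub, hd] at h3
      exact hX.of_mul (mem_nonZeroDivisors_of_ne_zero PowerSeries.X_ne_zero) h3)
    simpa using h2

end PowerSeriesCoeff

section FixedVectors

/-- A space of vectors that is stable under a semilinear map `s`, and on which finitely many
linear coordinates compatible with `s` are jointly injective, is spanned by vectors fixed by `s`: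
choose coordinates that form a basis of the dual space, and take the dual basis. -/
theorem le_span_fixed {κ L ι : Type*} [Field κ] [AddCommGroup L] [Module κ L] [Finite ι]
    (V : Submodule κ L) (s : L → L) (hsV : ∀ v ∈ V, s v ∈ V) (φ : κ →+* κ)
    (l : ι → V →ₗ[κ] κ) (hl : ∀ v, (∀ i, l i v = 0) → v = 0)
    (hls : ∀ i (v : V), l i ⟨s v, hsV v v.2⟩ = φ (l i v)) :
    V ≤ Submodule.span κ {v | s v = v} := by
  classical
  have hinj : Function.Injective (LinearMap.pi l) :=
    (injective_iff_map_eq_zero _).2 fun v hv => hl v fun i => congrFun hv i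
  have : FiniteDimensional κ V := FiniteDimensional.of_injective _ hinj
  have hspan : ⊤ ≤ Submodule.span κ (Set.range l) := by
    refine (Submodule.span_eq_top_of_ne_zero fun v hv => ?_).ge
    contrapose! hv
    exact hl v fun i => hv _ ⟨i, rfl⟩
  let b := Module.Basis.ofSpan hspan
  have hb : ∀ i, ∃ j, l j = b i := fun i => Module.Basis.ofSpan_subset hspan ⟨i, rfl⟩
  choose j hj using hb
  let e := fun i => (Module.evalEquiv κ V).symm (b.coord i)
  have he : ∀ i i', b i' (e i) = if i = i' then 1 else 0 := fun i i' => by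
    rw [Module.apply_evalEquiv_symm_apply, b.coord_apply, b.repr_self, Finsupp.single_apply]
    simp only [eq_comm]
  have hzero : ∀ v : V, (∀ i, b i v = 0) → v = 0 := by
    intro v hv
    refine hl v fun k => ?_
    have h1 : Module.evalEquiv κ V v = 0 := b.ext fun i => hv i
    rw [(map_eq_zero_iff _ (Module.evalEquiv κ V).injective).1 h1, map_zero]
  have : Fintype ((linearIndepOn_empty κ id).extend (Set.empty_subset (Set.range l))) :=
    FiniteDimensional.fintypeBasisIndex b
  have hes : ∀ i, s (e i) = e i := by
    intro i
    refine congrArg Subtype.val (sub_eq_zero.1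
      (hzero (⟨s (e i), hsV _ (e i).2⟩ - e i) fun i' => ?_))
    rw [map_sub, ← hj i', hls, hj i', he]
    split_ifs <;> simp
  intro v hv
  have hv' : (⟨v, hv⟩ : V) = ∑ i, b i ⟨v, hv⟩ • e i := by
    refine sub_eq_zero.1 (hzero _ fun i' => ?_)
    rw [map_sub, map_sum]
    simp [he]
  have hv2 := congrArg Subtype.val hv'
  rw [AddSubmonoidClass.coe_finsetSum] at hv2
  change v = _ at hv2
  rw [hv2]
  exact sum_mem fun i _ => Submodule.smul_mem _ _ (Submodule.subset_span (hes i))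

end FixedVectors

/-! ### Sections of `𝒪(N)` in an extension of `κ(t)` -/

section MinpolyCoeffZero

variable {A K L : Type*} [CommRing A] [Field K] [Field L] [Algebra A K] [Algebra K L]
  [Algebra A L] [IsScalarTower A K L]

/-- An integral element divides the constant coefficient of its minimal polynomial. -/
theorem exists_mul_eq_coeff_zero_minpoly [IsDomain A] [IsIntegrallyClosed A]
    [IsFractionRing A K] {y : L} (hy : IsIntegral A y) :
    ∃ (a : A) (w : L), algebraMap A K a = (minpoly K y).coeff 0 ∧ IsIntegral A w ∧
      y * w = algebraMap A L a := by
  refine ⟨(minpoly A y).coeff 0, -Polynomial.aeval y (minpoly A y).divX, ?_, ?_, ?_⟩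
  · rw [minpoly.isIntegrallyClosed_eq_field_fractions' K hy, Polynomial.coeff_map]
  · exact (IsIntegral.of_mem_of_fg _ hy.fg_adjoin_singleton _
      (Polynomial.aeval_mem_adjoin_singleton A y)).neg
  · have h := minpoly.aeval A y
    rw [← Polynomial.divX_mul_X_add (minpoly A y), map_add, map_mul, Polynomial.aeval_X,
      Polynomial.aeval_C] at h
    linear_combination -h

open IntermediateField in
/-- The constant coefficient of the minimal polynomial is, up to sign, a norm. -/
theorem isIntegral_pow_mul_coeff_zero_minpoly {u : K} {y : L} (hy : IsIntegral K y)
    (h : IsIntegral A (algebraMap K L u * y)) :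
    IsIntegral A (u ^ (minpoly K y).natDegree * (minpoly K y).coeff 0) := by
  let : Algebra A K⟮y⟯ := ((algebraMap K K⟮y⟯).comp (algebraMap A K)).toAlgebra
  have : IsScalarTower A K K⟮y⟯ := .of_algebraMap_eq' rfl
  have : IsScalarTower A K⟮y⟯ L := .of_algebraMap_eq fun a => by
    rw [IsScalarTower.algebraMap_apply A K L]
    rfl
  have h1 : IsIntegral A (algebraMap K K⟮y⟯ u * AdjoinSimple.gen K y) := by
    rw [← isIntegral_algebraMap_iff (B := L) (algebraMap K⟮y⟯ L).injective]
    exact h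
  have h2 := Algebra.isIntegral_norm (K := K) h1
  have h3 := Algebra.PowerBasis.norm_gen_eq_coeff_zero_minpoly (adjoin.powerBasis hy)
  rw [adjoin.powerBasis_gen, adjoin.powerBasis_dim, minpoly_gen] at h3
  rw [map_mul, Algebra.norm_algebraMap, adjoin.finrank hy, h3] at h2
  have h4 : IsIntegral A ((-1 : K) ^ (minpoly K y).natDegree) :=
    ((isIntegral_one (R := A) (B := K)).neg).pow _
  have h5 : u ^ (minpoly K y).natDegree * (minpoly K y).coeff 0 =
      u ^ (minpoly K y).natDegree * ((-1) ^ (minpoly K y).natDegree * (minpoly K y).coeff 0) *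
        (-1) ^ (minpoly K y).natDegree := by
    have h6 : (-1 : K) ^ (minpoly K y).natDegree * (-1) ^ (minpoly K y).natDegree = 1 := by
      rw [← mul_pow, neg_one_mul, neg_neg, one_pow]
    linear_combination -(u ^ (minpoly K y).natDegree * (minpoly K y).coeff 0) * h6
  rw [h5]
  exact h2.mul h4

end MinpolyCoeffZero

section Sections

open Polynomial IntermediateField

variable {κ K : Type*} (L : Type*) [Field κ] [Field K] [Field L] [Algebra κ K] [Algebra K L]

/-- The ring homomorphism `κ[X] → L`, `X ↦ u`. -/
noncomputable def polyHom (κ : Type*) [Field κ] [Algebra κ K] (u : K) : κ[X] →+* L :=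
  (algebraMap K L).comp (aeval (R := κ) u).toRingHom

variable {L}

theorem polyHom_apply (u : K) (P : κ[X]) : polyHom L κ u P = algebraMap K L (aeval u P) := rfl

/-- The elements of `L` that are integral over `κ[t]`, and become integral over `κ[1 / t]`
after multiplication by `1 / t ^ N`. If `K = κ(t)` and `L` is finite over `K`, then these are the
global sections of `𝒪(N)` on the normalization of the projective line in `L`. -/
noncomputable def boundedSections (κ L : Type*) [Field κ] [Field L] [Algebra κ K] [Algebra K L]
    [Algebra κ L] [IsScalarTower κ K L] (t : K) (N : ℕ) : Submodule κ L where
  carrier := {y | (polyHom L κ t).IsIntegralElem y ∧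
    (polyHom L κ t⁻¹).IsIntegralElem (algebraMap K L t⁻¹ ^ N * y)}
  add_mem' := fun {a b} ha hb => ⟨ha.1.add _ hb.1, by
    rw [mul_add]
    exact ha.2.add _ hb.2⟩
  zero_mem' := by
    constructor
    · exact RingHom.isIntegralElem_zero _
    · rw [mul_zero]
      exact RingHom.isIntegralElem_zero _
  smul_mem' := fun c y hy => by
    have hc : ∀ u : K, (polyHom L κ u).IsIntegralElem (algebraMap κ L c) := fun u => by
      have h : algebraMap κ L c = polyHom L κ u (C c) := by
        rw [polyHom_apply, aeval_C, ← IsScalarTower.algebraMap_apply]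
      rw [h]
      exact RingHom.isIntegralElem_map _
    constructor
    · rw [Algebra.smul_def]
      exact (hc _).mul _ hy.1
    · rw [Algebra.smul_def, mul_left_comm]
      exact (hc _).mul _ hy.2

theorem isFractionRing_of_adjoin_eq_top {u : K} (hu : Transcendental κ u) (hK : κ⟮u⟯ = ⊤) :
    let := (aeval (R := κ) u).toRingHom.toAlgebra
    IsFractionRing κ[X] K := by
  let := (aeval (R := κ) u).toRingHom.toAlgebra
  have : FaithfulSMul κ[X] K := (faithfulSMul_iff_algebraMap_injective _ _).2
    (transcendental_iff_injective.1 hu)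
  refine IsFractionRing.of_field _ _ fun x => ?_
  have hx : x ∈ κ⟮u⟯ := hK ▸ mem_top
  exact (mem_adjoin_simple_iff κ x).1 hx

theorem transcendental_inv {u : K} (hu : Transcendental κ u) : Transcendental κ u⁻¹ :=
  fun h => hu (by simpa using h.inv)

theorem adjoin_simple_inv (u : K) : κ⟮u⁻¹⟯ = κ⟮u⟯ := by
  refine le_antisymm (adjoin_simple_le_iff.2 (inv_mem (mem_adjoin_simple_self κ u)))
    (adjoin_simple_le_iff.2 ?_)
  have := inv_mem (mem_adjoin_simple_self κ u⁻¹)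
  rwa [inv_inv] at this

/-- For a suitable `m`, a polynomial in `1 / u` becomes a polynomial in `u` after multiplication
by `u ^ m`. -/
theorem aeval_inv_mul_pow {u : K} (hu : u ≠ 0) {m : ℕ} {P : κ[X]} (hP : P.natDegree ≤ m) :
    aeval u⁻¹ (reflect m P) * u ^ m = aeval u P := by
  let : Invertible u := invertibleOfNonzero hu
  have := eval₂_reflect_mul_pow (algebraMap κ K) u m P hP
  rwa [invOf_eq_inv] at this

/-- The constant coefficient of the minimal polynomial of a section of `𝒪(N)` is a section of
`𝒪(N d)` on the projective line, where `d` is the degree. -/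
theorem exists_mul_eq_of_mem_boundedSections [Algebra κ L] [IsScalarTower κ K L] {t : K}
    (ht : Transcendental κ t) (hK : κ⟮t⟯ = ⊤) {N : ℕ} {y : L} (hy : y ∈ boundedSections κ L t N)
    (hy0 : y ≠ 0) :
    ∃ (a : κ[X]) (w : L), a ≠ 0 ∧ a.natDegree ≤ N * (minpoly K y).natDegree ∧
      (polyHom L κ t).IsIntegralElem w ∧ y * w = polyHom L κ t a := by
  set d := (minpoly K y).natDegree
  have ht0 : t ≠ 0 := fun h => ht (h ▸ isAlgebraic_zero)
  obtain ⟨a, w, ha, hw, hyw, hyK⟩ : ∃ (a : κ[X]) (w : L), aeval t a = (minpoly K y).coeff 0 ∧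
      (polyHom L κ t).IsIntegralElem w ∧ y * w = polyHom L κ t a ∧ IsIntegral K y := by
    let := (aeval (R := κ) t).toRingHom.toAlgebra
    let := (polyHom L κ t).toAlgebra
    have : IsScalarTower κ[X] K L := .of_algebraMap_eq' rfl
    have := isFractionRing_of_adjoin_eq_top ht hK
    have hy1 : IsIntegral κ[X] y := hy.1
    obtain ⟨a, w, h1, h2, h3⟩ := exists_mul_eq_coeff_zero_minpoly (K := K) hy1
    exact ⟨a, w, h1, h2, h3, hy1.tower_top⟩
  obtain ⟨b, hb⟩ : ∃ b : κ[X], aeval t⁻¹ b = t⁻¹ ^ (N * d) * (minpoly K y).coeff 0 := by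
    let := (aeval (R := κ) t⁻¹).toRingHom.toAlgebra
    let := (polyHom L κ t⁻¹).toAlgebra
    have : IsScalarTower κ[X] K L := .of_algebraMap_eq' rfl
    have := isFractionRing_of_adjoin_eq_top (transcendental_inv ht)
      ((adjoin_simple_inv t).trans hK)
    have hy1 : IsIntegral κ[X] (algebraMap K L (t⁻¹ ^ N) * y) := by
      rw [map_pow]
      exact hy.2
    have h2 := isIntegral_pow_mul_coeff_zero_minpoly hyK hy1
    rw [← pow_mul] at h2
    exact IsIntegrallyClosed.isIntegral_iff.1 h2
  have ha0 : a ≠ 0 := by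
    rintro rfl
    rw [map_zero] at ha
    exact hy0 ((minpoly.coeff_zero_eq_zero hyK).1 ha.symm)
  refine ⟨a, w, ha0, ?_, hw, hyw⟩
  -- clear denominators in `a(t) = t ^ (N * d) * b(1 / t)`
  have h1 : aeval t (a * X ^ b.natDegree) = aeval t (reflect b.natDegree b * X ^ (N * d)) := by
    have h2 := aeval_inv_mul_pow (κ := κ) (inv_ne_zero ht0) (P := b) le_rfl
    rw [inv_inv] at h2
    rw [map_mul, map_mul, map_pow, map_pow, aeval_X, ha]
    rw [← h2] at hb
    have h3 : t ^ (N * d) * t⁻¹ ^ (N * d) = 1 := by rw [← mul_pow, mul_inv_cancel₀ ht0, one_pow]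
    have h4 : t ^ b.natDegree * t⁻¹ ^ b.natDegree = 1 := by
      rw [← mul_pow, mul_inv_cancel₀ ht0, one_pow]
    linear_combination -hb * t ^ b.natDegree * t ^ (N * d) -
      (minpoly K y).coeff 0 * t ^ b.natDegree * h3 +
      aeval t (reflect b.natDegree b) * t ^ (N * d) * h4
  have h3 := congrArg natDegree (transcendental_iff_injective.1 ht h1)
  rw [natDegree_mul_X_pow _ ha0] at h3
  have h4 : (reflect b.natDegree b * X ^ (N * d)).natDegree ≤ b.natDegree + N * d :=
    natDegree_mul_le.trans (add_le_add ((natDegree_reflect_le).trans (max_self _).le)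
      (natDegree_X_pow_le _))
  omega

/-- The multiples of an algebraic element by some polynomials in `t` are sections of `𝒪(N)`
for large `N`. -/
theorem exists_mul_mem_boundedSections [Algebra κ L] [IsScalarTower κ K L] {t : K}
    (ht : Transcendental κ t) (hK : κ⟮t⟯ = ⊤) {y : L} (hy : IsAlgebraic K y) :
    ∃ (b : κ[X]) (N : ℕ), b ≠ 0 ∧ polyHom L κ t b * y ∈ boundedSections κ L t N := by
  have ht0 : t ≠ 0 := fun h => ht (h ▸ isAlgebraic_zero)
  obtain ⟨b, hb0, hb⟩ : ∃ b : κ[X], b ≠ 0 ∧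
      (polyHom L κ t).IsIntegralElem (polyHom L κ t b * y) := by
    let := (aeval (R := κ) t).toRingHom.toAlgebra
    let := (polyHom L κ t).toAlgebra
    have : IsScalarTower κ[X] K L := .of_algebraMap_eq' rfl
    have := isFractionRing_of_adjoin_eq_top ht hK
    exact ((IsFractionRing.isAlgebraic_iff κ[X] K L).2 hy).exists_integral_multiple
  obtain ⟨P, hP, hPz⟩ := hb
  set z := polyHom L κ t b * y
  let d := P.natDegree
  let N := (Finset.range d).sup fun i => (P.coeff i).natDegree
  refine ⟨b, N, hb0, ⟨P, hP, hPz⟩, ?_⟩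
  -- multiply the `i`-th coefficient of a relation of degree `d` for `z` by `1 / t ^ (N * (d - i))`
  let R : κ[X][X] := ∑ i ∈ Finset.range d, C (reflect (N * (d - i)) (P.coeff i)) * X ^ i
  have hR : R.degree < d := by
    refine (degree_sum_le _ _).trans_lt
      ((Finset.sup_lt_iff (WithBot.bot_lt_coe d)).2 fun i hi => ?_)
    exact (degree_C_mul_X_pow_le _ _).trans_lt
      (WithBot.coe_lt_coe.2 (Nat.cast_lt.2 (Finset.mem_range.1 hi)))
  refine ⟨X ^ d + R, monic_X_pow_add hR, ?_⟩
  rw [eval₂_eq_sum_range, Finset.sum_range_succ] at hPz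
  change _ + polyHom L κ t (P.coeff d) * z ^ d = 0 at hPz
  rw [show P.coeff d = 1 from hP, map_one, one_mul] at hPz
  rw [eval₂_add, eval₂_X_pow, eval₂_finsetSum]
  calc (algebraMap K L t⁻¹ ^ N * z) ^ d + ∑ i ∈ Finset.range d,
        eval₂ (polyHom L κ t⁻¹) (algebraMap K L t⁻¹ ^ N * z)
          (C (reflect (N * (d - i)) (P.coeff i)) * X ^ i)
      = algebraMap K L t⁻¹ ^ (N * d) *
        (∑ i ∈ Finset.range d, polyHom L κ t (P.coeff i) * z ^ i + z ^ d) := by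
        rw [mul_add, Finset.mul_sum, add_comm, mul_pow, ← pow_mul]
        congr 1
        refine Finset.sum_congr rfl fun i hi => ?_
        have hid := Finset.mem_range.1 hi
        have hdeg : (P.coeff i).natDegree ≤ N * (d - i) :=
          (Finset.le_sup (f := fun i => (P.coeff i).natDegree) hi).trans
            (Nat.le_mul_of_pos_right _ (by omega))
        have h1 := congrArg (algebraMap K L) (aeval_inv_mul_pow (κ := κ) ht0 hdeg)
        rw [map_mul, map_pow] at h1
        rw [eval₂_mul, eval₂_C, eval₂_X_pow, polyHom_apply, polyHom_apply, ← h1, mul_pow, ← pow_mul,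
          show N * d = N * (d - i) + N * i by rw [← mul_add]; congr 1; omega, pow_add]
        have h2 : algebraMap K L t⁻¹ ^ (N * (d - i)) * algebraMap K L t ^ (N * (d - i)) = 1 := by
          rw [← mul_pow, ← map_mul, inv_mul_cancel₀ ht0, map_one, one_pow]
        linear_combination -(algebraMap K L (aeval t⁻¹ (reflect (N * (d - i)) (P.coeff i))) *
          algebraMap K L t⁻¹ ^ (N * i) * z ^ i) * h2
    _ = 0 := by rw [hPz, mul_zero]

end Sections

/-! ### Extensions of `κ(t)` that are stable under a twist of the coefficients -/

section LaurentDescent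

open Polynomial IntermediateField

variable {κ K L C : Type*} [Field κ] [Field K] [Field L] [Field C] [Algebra κ K] [Algebra K L]
  [Algebra κ C]

/-- Power series over a field are integrally closed in Laurent series, so an embedding of `L`
into Laurent series that is compatible with `κ[t]` takes integral elements to power series. -/
theorem exists_powerSeries_of_isIntegralElem {t : K} (ℓ : L →+* LaurentSeries C)
    (hℓ : ∀ P : κ[X], ℓ (polyHom L κ t P) =
      HahnSeries.ofPowerSeries ℤ C (algebraMap κ[X] (PowerSeries C) P))
    {y : L} (hy : (polyHom L κ t).IsIntegralElem y) :
    ∃ Y : PowerSeries C, ℓ y = HahnSeries.ofPowerSeries ℤ C Y ∧ IsIntegral κ[X] Y := by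
  obtain ⟨P, hP, hPy⟩ := hy
  have hcomp : ℓ.comp (polyHom L κ t) =
      (HahnSeries.ofPowerSeries ℤ C).comp (algebraMap κ[X] (PowerSeries C)) := RingHom.ext hℓ
  have h1 := congrArg ℓ hPy
  rw [hom_eval₂, hcomp, map_zero] at h1
  have h2 : IsIntegral (PowerSeries C) (ℓ y) := by
    refine ⟨P.map (algebraMap κ[X] (PowerSeries C)), hP.map _, ?_⟩
    rw [eval₂_map]
    exact h1
  obtain ⟨Y, hY⟩ := IsIntegrallyClosed.isIntegral_iff.1 h2
  rw [LaurentSeries.coe_algebraMap] at hY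
  refine ⟨Y, hY.symm, P, hP, HahnSeries.ofPowerSeries_injective (Γ := ℤ) ?_⟩
  rw [hom_eval₂, hY, h1, map_zero]

/-- Sections of `𝒪(N)` are preserved by a field endomorphism that fixes `t` and preserves `κ`. -/
theorem map_mem_boundedSections [Algebra κ L] [IsScalarTower κ K L] {t : K} (σ : L →+* L)
    (φ : κ →+* κ) (hσ : ∀ a, σ (algebraMap κ L a) = algebraMap κ L (φ a))
    (hσt : σ (algebraMap K L t) = algebraMap K L t) {N : ℕ} {y : L}
    (hy : y ∈ boundedSections κ L t N) : σ y ∈ boundedSections κ L t N := by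
  have key : ∀ u : K, σ (algebraMap K L u) = algebraMap K L u → ∀ z : L,
      (polyHom L κ u).IsIntegralElem z → (polyHom L κ u).IsIntegralElem (σ z) := by
    rintro u hu z ⟨P, hP, hPz⟩
    refine ⟨P.map (mapRingHom φ), hP.map _, ?_⟩
    have hcomp : (polyHom L κ u).comp (mapRingHom φ) = σ.comp (polyHom L κ u) := by
      refine Polynomial.ringHom_ext (fun a => ?_) ?_
      · simp only [RingHom.comp_apply, polyHom_apply, coe_mapRingHom, map_C, aeval_C]
        rw [← IsScalarTower.algebraMap_apply, ← IsScalarTower.algebraMap_apply, hσ]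
      · simp only [RingHom.comp_apply, polyHom_apply, coe_mapRingHom, map_X, aeval_X]
        exact hu.symm
    rw [eval₂_map, hcomp, ← hom_eval₂, hPz, map_zero]
  have hinv : σ (algebraMap K L t⁻¹) = algebraMap K L t⁻¹ := by
    rw [map_inv₀, map_inv₀, hσt]
  refine ⟨key t hσt _ hy.1, ?_⟩
  have h := key t⁻¹ hinv _ hy.2
  rwa [map_mul, map_pow, hinv] at h

/-- A finite extension `E` of `K = κ(t)` inside a field of Laurent series with coefficients in an
extension of `κ` in which `κ` is algebraically closed, that is stable under a twist `σ` of the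
coefficients whose fixed elements lie in `K`, is equal to `K`. The sections of `𝒪(N)` in `E` are
determined by their first Taylor coefficients at `t = 0`, so they are spanned by sections fixed
by `σ`. -/
theorem eq_bot_of_stable [Algebra κ L] [IsScalarTower κ K L] {t : K}
    (ht : Transcendental κ t) (hK : κ⟮t⟯ = ⊤)
    (hκ : ∀ c : C, IsAlgebraic κ c → c ∈ (algebraMap κ C).range)
    (ℓ : L →+* LaurentSeries C)
    (hℓ : ∀ P : κ[X], ℓ (polyHom L κ t P) =
      HahnSeries.ofPowerSeries ℤ C (algebraMap κ[X] (PowerSeries C) P))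
    (σ : L →+* L) (φ : κ →+* κ) (ψ : C →+* C)
    (hφ : ∀ a, ψ (algebraMap κ C a) = algebraMap κ C (φ a))
    (hσ : ∀ a, σ (algebraMap κ L a) = algebraMap κ L (φ a))
    (hσt : σ (algebraMap K L t) = algebraMap K L t)
    (hσℓ : ∀ y Y, ℓ y = HahnSeries.ofPowerSeries ℤ C Y →
      ℓ (σ y) = HahnSeries.ofPowerSeries ℤ C (PowerSeries.map ψ Y))
    (hfix : ∀ y, σ y = y → y ∈ (algebraMap K L).range)
    (E : IntermediateField K L) [FiniteDimensional K E] (hE : ∀ y ∈ E, σ y ∈ E) : E = ⊥ := by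
  classical
  have hinj := HahnSeries.ofPowerSeries_injective (Γ := ℤ) (R := C)
  have hmain : ∀ N, ∀ y ∈ E, y ∈ boundedSections κ L t N → y ∈ (⊥ : IntermediateField K L) := by
    intro N
    let V : Submodule κ L :=
      boundedSections κ L t N ⊓ (Subalgebra.toSubmodule E.toSubalgebra).restrictScalars κ
    have hV : ∀ v : V, ∃ Y : PowerSeries C, ℓ v = HahnSeries.ofPowerSeries ℤ C Y ∧
        IsIntegral κ[X] Y := fun v => exists_powerSeries_of_isIntegralElem ℓ hℓ v.2.1.1
    choose Y hY hYint using hV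
    have hYadd : ∀ v w, Y (v + w) = Y v + Y w := fun v w => hinj (by
      rw [← hY, map_add, ← hY, ← hY, ← map_add]
      rfl)
    have hYsmul : ∀ (a : κ) v, Y (a • v) = PowerSeries.C (algebraMap κ C a) * Y v := fun a v =>
      hinj (by
        have h1 : algebraMap κ L a = polyHom L κ t (Polynomial.C a) := by
          rw [polyHom_apply, aeval_C, ← IsScalarTower.algebraMap_apply]
        rw [← hY, map_mul, ← hY, Submodule.coe_smul, Algebra.smul_def, map_mul, h1, hℓ]
        simp [PowerSeries.algebraMap_apply'])
    -- the Taylor coefficients lie in `κ`, as they are algebraic over it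
    choose l hl using fun (n : ℕ) (v : V) => hκ _ (isAlgebraic_coeff (hYint v).isAlgebraic n)
    have hκinj := (algebraMap κ C).injective
    let lin : Fin (N * Module.finrank K E + 1) → V →ₗ[κ] κ := fun n =>
      { toFun := l n
        map_add' := fun v w => hκinj (by simp only [map_add, hl, hYadd])
        map_smul' := fun a v => hκinj (by
          simp only [RingHom.id_apply, smul_eq_mul, map_mul, hl, hYsmul,
            PowerSeries.coeff_C_mul]) }
    have hsV : ∀ v ∈ V, σ v ∈ V := fun v hv =>
      ⟨map_mem_boundedSections σ φ hσ hσt hv.1, hE v hv.2⟩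
    have hspan : V ≤ Submodule.span κ {v | σ v = v} := by
      refine le_span_fixed V σ hsV φ lin (fun v hv => ?_) fun n v => hκinj ?_
      · -- `v` divides a nonzero polynomial `a` of degree at most `N * [E : K]`, so it cannot
        -- vanish at `t = 0` to a higher order
        by_contra hv0
        obtain ⟨a, w, ha0, hdeg, hw, hvw⟩ := exists_mul_eq_of_mem_boundedSections ht hK v.2.1
          (fun h => hv0 (Subtype.ext h))
        obtain ⟨W, hW, -⟩ := exists_powerSeries_of_isIntegralElem ℓ hℓ hw
        have h1 : Y v * W = algebraMap κ[X] (PowerSeries C) a := hinj (by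
          rw [map_mul, ← hY, ← hW, ← map_mul, hvw, hℓ])
        have h2 : PowerSeries.X ^ (N * Module.finrank K E + 1) ∣ Y v :=
          PowerSeries.X_pow_dvd_iff.2 fun n hn => by
            rw [← hl, show l n v = 0 from hv ⟨n, hn⟩, map_zero]
        have h3 := PowerSeries.X_pow_dvd_iff.1 (h1 ▸ h2.mul_right W)
        have h4 : (minpoly K (v : L)).natDegree ≤ Module.finrank K E := by
          have h5 := minpoly.natDegree_le (A := K) (⟨v, v.2.2⟩ : E)
          rwa [← minpoly.algebraMap_eq (algebraMap E L).injective] at h5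
        have h6 := h3 a.natDegree (Nat.lt_succ_of_le (hdeg.trans (Nat.mul_le_mul_left N h4)))
        rw [PowerSeries.algebraMap_apply', PowerSeries.coeff_map, coeff_coe] at h6
        exact ha0 (leadingCoeff_eq_zero.1 (hκinj (h6.trans (map_zero _).symm)))
      · change algebraMap κ C (l n _) = algebraMap κ C (φ (l n v))
        have h1 : Y ⟨σ v, hsV v v.2⟩ = PowerSeries.map ψ (Y v) :=
          hinj (by rw [← hY, ← hσℓ _ _ (hY v)])
        rw [hl, ← hφ, hl, h1, PowerSeries.coeff_map]
    have hbot : Submodule.span κ {v | σ v = v} ≤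
        (Subalgebra.toSubmodule (⊥ : IntermediateField K L).toSubalgebra).restrictScalars κ :=
      Submodule.span_le.2 fun v hv => hfix v hv
    exact fun y hyE hyN => hbot (hspan ⟨hyN, hyE⟩)
  refine eq_bot_iff.2 fun x hx => ?_
  have hxalg : IsAlgebraic K x := by
    have := Algebra.IsAlgebraic.isAlgebraic (R := K) (⟨x, hx⟩ : E)
    exact this.algebraMap (A := L)
  -- clear the denominators of `x` to obtain a section
  obtain ⟨b, N, hb, hbx⟩ := exists_mul_mem_boundedSections ht hK hxalg
  have hb0 : aeval t b ≠ 0 := fun h =>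
    hb (transcendental_iff_injective.1 ht (by rw [h, map_zero]))
  have h1 := hmain N _ (mul_mem (E.algebraMap_mem _) hx) hbx
  obtain ⟨c, hc⟩ := mem_bot.1 h1
  refine mem_bot.2 ⟨c / aeval t b, ?_⟩
  rw [map_div₀, hc]
  change algebraMap K L (aeval t b) * x / _ = x
  rw [mul_div_cancel_left₀ _ (by simpa using hb0)]

end LaurentDescent

/-! ### The algebraic closure of `k̄(t)` in the field of solutions -/

section Solutions

variable {K L : Type*} [Field K] [Field L] [Algebra K L]

theorem isAlgebraic_map_of_comp_eq {x : L} (hx : IsAlgebraic K x) (σ : L →+* L) (τ : K →+* K)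
    (hτ : ∀ a, σ (algebraMap K L a) = algebraMap K L (τ a)) : IsAlgebraic K (σ x) := by
  obtain ⟨P, hP0, hP⟩ := hx
  refine ⟨P.map τ, (Polynomial.map_ne_zero_iff τ.injective).2 hP0, ?_⟩
  have h := congrArg σ hP
  rw [map_zero, Polynomial.aeval_def, Polynomial.hom_eval₂] at h
  rw [Polynomial.aeval_def, Polynomial.eval₂_map, ← h]
  congr 1
  exact RingHom.ext fun a => (hτ a).symm

/-- The relation `σ(Ψ) = Φ Ψ` makes `K(Ψ)` stable under `σ`. -/
theorem map_mem_solutionField {r : ℕ} {Φ : GL (Fin r) K} {Ψ : GL (Fin r) L} (σ : L →+* L)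
    (hΨ : Matrix.GeneralLinearGroup.map σ Ψ =
      Matrix.GeneralLinearGroup.map (algebraMap K L) Φ * Ψ) (τ : K →+* K)
    (hτ : ∀ a, σ (algebraMap K L a) = algebraMap K L (τ a)) {x : L}
    (hx : x ∈ solutionField K Ψ) : σ x ∈ solutionField K Ψ := by
  induction hx using IntermediateField.adjoin_induction with
  | mem x hx =>
    obtain ⟨ij, rfl⟩ := hx
    have h : σ ((Ψ : Matrix (Fin r) (Fin r) L) ij.1 ij.2) =
        ∑ k, algebraMap K L ((Φ : Matrix (Fin r) (Fin r) K) ij.1 k) *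
          (Ψ : Matrix (Fin r) (Fin r) L) k ij.2 :=
      congrArg (fun M : GL (Fin r) L => (M : Matrix (Fin r) (Fin r) L) ij.1 ij.2) hΨ
    rw [h]
    exact sum_mem fun k _ => mul_mem (IntermediateField.algebraMap_mem _ _)
      (IntermediateField.subset_adjoin _ _ ⟨(k, ij.2), rfl⟩)
  | algebraMap a =>
    rw [hτ]
    exact IntermediateField.algebraMap_mem _ _
  | add x y _ _ hx hy => rw [map_add]; exact add_mem hx hy
  | inv x _ hx => rw [map_inv₀]; exact inv_mem hx
  | mul x y _ _ hx hy => rw [map_mul]; exact mul_mem hx hy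

instance essFiniteType_solutionField {r : ℕ} (Ψ : GL (Fin r) L) :
    Algebra.EssFiniteType K (solutionField K Ψ) :=
  IntermediateField.essFiniteType_iff.2 (IntermediateField.fg_adjoin_of_finite (Set.finite_range _))

open Polynomial in
/-- The form of `eq_bot_of_stable` for the algebraic elements of the field generated by a solution
matrix of a difference equation. -/
theorem algebraicClosure_solutionField_eq_bot {κ C : Type*} [Field κ] [Field C] [Algebra κ C]
    (c : κ →+* K) (t : K) (hK : Subfield.closure (insert t (Set.range c)) = ⊤)
    (hκ : ∀ a : C, IsAlgebraic κ a → a ∈ (algebraMap κ C).range)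
    (ℓ : L →+* LaurentSeries C)
    (hℓ : ∀ P : κ[X], ℓ (algebraMap K L (P.eval₂ c t)) =
      HahnSeries.ofPowerSeries ℤ C (P.map (algebraMap κ C) : C[X]))
    (σ : L →+* L) (τ : K →+* K) (hτ : ∀ a, σ (algebraMap K L a) = algebraMap K L (τ a))
    (φ : κ →+* κ) (ψ : C →+* C)
    (hφ : ∀ a, ψ (algebraMap κ C a) = algebraMap κ C (φ a))
    (hσ : ∀ a, τ (c a) = c (φ a)) (hσt : τ t = t)
    (hσℓ : ∀ y Y, ℓ y = HahnSeries.ofPowerSeries ℤ C Y →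
      ℓ (σ y) = HahnSeries.ofPowerSeries ℤ C (PowerSeries.map ψ Y))
    (hfix : ∀ y, σ y = y → y ∈ (algebraMap K L).range)
    {r : ℕ} {Φ : GL (Fin r) K} {Ψ : GL (Fin r) L}
    (hΨ : Matrix.GeneralLinearGroup.map σ Ψ =
      Matrix.GeneralLinearGroup.map (algebraMap K L) Φ * Ψ) :
    algebraicClosure K (solutionField K Ψ) = ⊥ := by
  let : Algebra κ K := c.toAlgebra
  let : Algebra κ L := ((algebraMap K L).comp c).toAlgebra
  have : IsScalarTower κ K L := .of_algebraMap_eq' rfl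
  have ht : Transcendental κ t := by
    refine transcendental_iff_injective.2 ((injective_iff_map_eq_zero _).2 fun P hP => ?_)
    have h1 := hℓ P
    rw [show P.eval₂ c t = 0 from hP, map_zero, map_zero] at h1
    have h2 := HahnSeries.ofPowerSeries_injective (h1.symm.trans (map_zero _).symm)
    exact (Polynomial.map_eq_zero _).1 (coe_eq_zero_iff.1 h2)
  have hKtop : IntermediateField.adjoin κ {t} = ⊤ := by
    rw [← IntermediateField.toSubfield_inj, IntermediateField.top_toSubfield, eq_top_iff, ← hK,
      Subfield.closure_le]
    refine Set.insert_subset (IntermediateField.mem_adjoin_simple_self κ t) ?_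
    rintro _ ⟨a, rfl⟩
    exact IntermediateField.algebraMap_mem _ a
  let E : IntermediateField K L :=
    (algebraicClosure K (solutionField K Ψ)).map (solutionField K Ψ).val
  have := finiteDimensional_algebraicClosure K (solutionField K Ψ)
  have : FiniteDimensional K E :=
    (IntermediateField.equivMap (algebraicClosure K (solutionField K Ψ))
      (solutionField K Ψ).val).toLinearEquiv.finiteDimensional
  have hEbot : E = ⊥ := by
    refine eq_bot_of_stable ht hKtop hκ ℓ (fun P => ?_) σ φ ψ hφ (fun a => ?_) ?_ hσℓ hfix E ?_
    · rw [PowerSeries.algebraMap_apply', ← Polynomial.polynomial_map_coe]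
      exact hℓ P
    · exact (hτ _).trans (congrArg _ (hσ a))
    · rw [hτ, hσt]
    · rintro _ ⟨x, hx, rfl⟩
      refine ⟨⟨σ x, map_mem_solutionField σ hΨ τ hτ x.2⟩, mem_algebraicClosure_iff.2 ?_, rfl⟩
      have h1 : IsAlgebraic K (x : L) := (mem_algebraicClosure_iff.1 hx).algebraMap (A := L)
      exact (isAlgebraic_algebraMap_iff (A := L)
        (algebraMap (solutionField K Ψ) L).injective).1 (isAlgebraic_map_of_comp_eq h1 σ τ hτ)
  refine eq_bot_iff.2 fun x hx => ?_
  have h1 : (x : L) ∈ E := ⟨x, hx, rfl⟩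
  rw [hEbot] at h1
  obtain ⟨a, ha⟩ := IntermediateField.mem_bot.1 h1
  exact IntermediateField.mem_bot.2 ⟨a, Subtype.ext ha⟩

end Solutions

section TateLaurent

variable (Fq : Type*) [Field Fq] [Fintype Fq]

theorem KBar.mem_range_of_isAlgebraic {a : CInf Fq} (ha : IsAlgebraic (KBar Fq) a) :
    a ∈ (algebraMap (KBar Fq) (CInf Fq)).range :=
  ⟨⟨a, mem_algebraicClosure_iff.2 (ha.restrictScalars (RatFunc Fq))⟩, rfl⟩

namespace TateField

theorem ofPowerSeries_subtype_injective : Function.Injective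
    ((HahnSeries.ofPowerSeries ℤ (CInf Fq)).comp
      (PowerSeries.IsRestricted.subring (R := CInf Fq) 1).subtype) :=
  HahnSeries.ofPowerSeries_injective.comp Subtype.val_injective

/-- The embedding of `𝕃` into the field of Laurent series over `𝕂`. -/
noncomputable def toLaurent : TateField Fq →+* LaurentSeries (CInf Fq) :=
  IsFractionRing.lift (ofPowerSeries_subtype_injective Fq)

theorem toLaurent_algebraMap (f : Tate Fq) :
    toLaurent Fq (algebraMap (Tate Fq) (TateField Fq) f) =
      HahnSeries.ofPowerSeries ℤ (CInf Fq) f.1 :=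
  IsFractionRing.lift_algebraMap _ f

theorem coe_frobTwist_symm (f : Tate Fq) : ((Tate.frobTwist Fq).symm f).1 =
    PowerSeries.map (CInf.frob Fq).symm.toRingHom f.1 := by
  refine PowerSeries.map_injective _ (CInf.frob Fq).injective
    (a₁ := ((Tate.frobTwist Fq).symm f).1) ?_
  have h1 : PowerSeries.map (CInf.frob Fq).toRingHom ((Tate.frobTwist Fq).symm f).1 = f.1 :=
    congrArg Subtype.val ((Tate.frobTwist Fq).apply_symm_apply f)
  refine h1.trans (PowerSeries.ext fun n => ?_)
  change _ = PowerSeries.coeff n (PowerSeries.map (CInf.frob Fq).toRingHom _)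
  rw [PowerSeries.coeff_map, PowerSeries.coeff_map]
  exact ((CInf.frob Fq).apply_symm_apply _).symm

theorem toLaurent_sigma {y : TateField Fq} {Y : PowerSeries (CInf Fq)}
    (h : toLaurent Fq y = HahnSeries.ofPowerSeries ℤ (CInf Fq) Y) :
    toLaurent Fq (sigma Fq y) = HahnSeries.ofPowerSeries ℤ (CInf Fq)
      (PowerSeries.map (CInf.frob Fq).symm.toRingHom Y) := by
  obtain ⟨f, g, hg, rfl⟩ := IsFractionRing.div_surjective (A := Tate Fq) y
  have hinj := HahnSeries.ofPowerSeries_injective (Γ := ℤ) (R := CInf Fq)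
  have hne : ∀ g : Tate Fq, g ≠ 0 → HahnSeries.ofPowerSeries ℤ (CInf Fq) g.1 ≠ 0 := fun g hg =>
    (map_ne_zero_iff _ hinj).2 fun h0 => hg (Subtype.ext h0)
  have hg0 : g ≠ 0 := nonZeroDivisors.ne_zero hg
  rw [map_div₀, toLaurent_algebraMap, toLaurent_algebraMap, div_eq_iff (hne g hg0), ← map_mul] at h
  rw [map_div₀, map_div₀, sigma_algebraMap, sigma_algebraMap, toLaurent_algebraMap,
    toLaurent_algebraMap, div_eq_iff (hne _ (by simpa using hg0)), ← map_mul, coe_frobTwist_symm,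
    coe_frobTwist_symm, hinj h, map_mul]

/-- The constants `k̄ → k̄(t)`. -/
noncomputable def constKBar : KBar Fq →+* ratKBar Fq :=
  ((const Fq).comp (algebraMap (KBar Fq) (CInf Fq))).codRestrict (ratKBar Fq)
    fun a => const_mem_ratKBar Fq a.2

/-- The restriction of `σ` to `k̄(t)`. -/
noncomputable def sigmaKBar : ratKBar Fq →+* ratKBar Fq :=
  ((sigma Fq).toRingHom.comp (ratKBar Fq).subtype).codRestrict (ratKBar Fq)
    fun a => sigma_mem_ratKBar Fq a.2

/-- The inverse of the Frobenius automorphism `a ↦ a ^ q` of `k̄`. -/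
noncomputable def frobSymmKBar : KBar Fq →+* KBar Fq :=
  ((CInf.frob Fq).symm.toRingHom.comp (algebraMap (KBar Fq) (CInf Fq))).codRestrict (KBar Fq)
    (frob_symm_mem Fq)

theorem coe_eval₂_constKBar (P : Polynomial (KBar Fq)) :
    ((P.eval₂ (constKBar Fq) ⟨t Fq, t_mem_ratKBar Fq⟩ : ratKBar Fq) : TateField Fq) =
      algebraMap (Tate Fq) (TateField Fq)
        (ofPoly Fq (P.map (algebraMap (KBar Fq) (CInf Fq)))) := by
  rw [ofPoly, Polynomial.coe_eval₂RingHom, Polynomial.eval₂_map, Polynomial.hom_eval₂]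
  exact Polynomial.hom_eval₂ P (constKBar Fq) (ratKBar Fq).subtype _

theorem closure_insert_eq_top {L : Type*} [Field L] {t : L} {S : Set L} {κ : Type*} [Field κ]
    (c : κ →+* Subfield.closure (insert t S)) (hc : ∀ s ∈ S, ∃ a, (c a : L) = s) :
    Subfield.closure (insert (⟨t, Subfield.subset_closure (Set.mem_insert _ _)⟩ :
      Subfield.closure (insert t S)) (Set.range c)) = ⊤ := by
  set T := Subfield.closure (insert (⟨t, Subfield.subset_closure (Set.mem_insert _ _)⟩ :
    Subfield.closure (insert t S)) (Set.range c))
  have h : Subfield.closure (insert t S) ≤ T.map (Subfield.closure (insert t S)).subtype := by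
    refine Subfield.closure_le.2 (Set.insert_subset ?_ fun s hs => ?_)
    · exact ⟨_, Subfield.subset_closure (Set.mem_insert _ _), rfl⟩
    · obtain ⟨a, ha⟩ := hc s hs
      exact ⟨c a, Subfield.subset_closure (Or.inr ⟨a, rfl⟩), ha⟩
  refine eq_top_iff.2 fun x _ => ?_
  obtain ⟨y, hy, hyx⟩ := h x.2
  rwa [← Subtype.ext hyx]

theorem algebraicClosure_ratKBar_solutionField {r : ℕ} (Φ : GL (Fin r) (ratKBar Fq))
    (Ψ : GL (Fin r) (TateField Fq))
    (hΨ : Matrix.GeneralLinearGroup.map (sigma Fq).toRingHom Ψ =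
      Matrix.GeneralLinearGroup.map (algebraMap (ratKBar Fq) (TateField Fq)) Φ * Ψ) :
    algebraicClosure (ratKBar Fq) (solutionField (ratKBar Fq) Ψ) = ⊥ := by
  refine algebraicClosure_solutionField_eq_bot (C := CInf Fq) (constKBar Fq)
    ⟨t Fq, t_mem_ratKBar Fq⟩ ?_ (fun a ha => KBar.mem_range_of_isAlgebraic Fq ha) (toLaurent Fq)
    (fun P => ?_) (sigma Fq).toRingHom (sigmaKBar Fq) (fun _ => rfl) (frobSymmKBar Fq)
    (CInf.frob Fq).symm.toRingHom (fun _ => rfl) (fun a => Subtype.ext (sigma_const Fq a))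
    (Subtype.ext (sigma_t Fq)) (fun y Y h => toLaurent_sigma Fq h)
    (fun y hy => ⟨⟨y, ratF_le_ratKBar Fq (mem_ratF_of_sigma_eq Fq hy)⟩, rfl⟩) hΨ
  · exact closure_insert_eq_top (constKBar Fq) (by rintro _ ⟨a, rfl⟩; exact ⟨a, rfl⟩)
  · change toLaurent Fq ((P.eval₂ (constKBar Fq) ⟨t Fq, t_mem_ratKBar Fq⟩ : ratKBar Fq) :
      TateField Fq) = _
    rw [coe_eval₂_constKBar, toLaurent_algebraMap, coe_ofPoly]

end TateField

end TateLaurent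

end TMotive

open TensorProduct in
theorem mainTheorem8 (Fq : Type*) [Field Fq] [Fintype Fq] (r : ℕ)
    (Φ : GL (Fin r) (TMotive.TateField.ratKBar Fq)) (Ψ : GL (Fin r) (TMotive.TateField Fq))
    (hΨ : Matrix.GeneralLinearGroup.map (TMotive.TateField.sigma Fq).toRingHom Ψ =
      Matrix.GeneralLinearGroup.map
        (algebraMap (TMotive.TateField.ratKBar Fq) (TMotive.TateField Fq)) Φ * Ψ) :
    algebraicClosure (TMotive.TateField.ratKBar Fq)
        (TMotive.solutionField (TMotive.TateField.ratKBar Fq) Ψ) = ⊥ ∧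
      Algebra.Smooth (AlgebraicClosure (TMotive.TateField.ratF Fq))
        (AlgebraicClosure (TMotive.TateField.ratF Fq) ⊗[TMotive.TateField.ratF Fq]
          TMotive.galoisRing (TMotive.TateField.ratF Fq) (TMotive.TateField.ratKBar Fq) Ψ) ∧
      IsReduced (AlgebraicClosure (TMotive.TateField.ratF Fq) ⊗[TMotive.TateField.ratF Fq]
          TMotive.galoisRing (TMotive.TateField.ratF Fq) (TMotive.TateField.ratKBar Fq) Ψ) := by
  exact ⟨TMotive.TateField.algebraicClosure_ratKBar_solutionField Fq Φ Ψ hΨ,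
    TMotive.smooth_and_isReduced_galoisRing Fq r Φ Ψ hΨ⟩
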